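/- Let $n\ge 2$ and let $\mathbb R_n$ be the real Clifford algebra generated by $e_1,\dots,e_n$ with $e_i^2=-1$, $e_ie_j=-e_je_i$ ($i\ne j$), with basis $e_A=e_{i_1}\cdots e_{i_r}$ ($A=\{i_1<\dots<i_r\}$), conjugation $x\mapsto\overline{x}$ (the linear anti-automorphism with $\overline{e_i}=-e_i$) and norm $|x|=(\sum_A x_A^2)^{1/2}$. Write points of $\mathbb R^n$ as $(x_1,\dots,x_{n-1},y)$, $y=x_n$, and let $\Omega\subset\{y>0\}\subset\mathbb R^n$ be an open set with $$\inf_{\Omega}y=m,\qquad \sup_{\Omega}y=M,\qquad 0<m<M<+\infty .$$ Let $L^2(\Omega)=L^2(\Omega,\mathbb R_n)$ with $\langle F,G\rangle_2=\int_\Omega\overline{F}G\,dx$ and $\|F\|_2^2=\int_\Omega|F|^2dx$ (Lebesgue measure), let $\|F\|_D^2=\sum_{i=1}^n\|\partial_{x_i}F\|_2^2$ (weak derivatives) for $F\in H^1(\Omega)=H^1(\Omega,\mathbb R_n)$, and let $H^1_0(\Omega)$ be the closure of $C_c^\infty(\Omega,\mathbb R_n)$ in $H^1(\Omega)$ for the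 norm $(\|F\|_2^2+\|F\|_D^2)^{1/2}$. Put $\alpha_n=\frac{n-1}2$, $\beta_n=\alpha_n+\alpha_n^2$, let $$\mathcal D_HF=\sum_{i=1}^{n-1}e_i\,y\,\partial_{x_i}F-\alpha_ne_nF+e_n\,y\,\partial_yF$$ be the Dirac operator on hyperbolic space, and for a paravector $s=s_0+s_1e_1+\dots+s_ne_n$ with real $s_j$ and $|s|^2=\sum_{j=0}^n s_j^2$ let $$q_s(F,G)=\sum_{i=1}^{n-1}\langle y^2\partial_{x_i}F,\partial_{x_i}G\rangle_2+\langle y^2\partial_yF,\partial_yG\rangle_2+2(1+\alpha_n)\langle y\partial_yF,G\rangle_2+\langle(e_n-2s_0)\mathcal D_HF,G\rangle_2+\langle(|s|^2-\beta_n)F,G\rangle_2$$ for $F,G\in H^1_0(\Omega)$; this is the sesquilinear form of the Dirichlet problem for $Q_s(\mathcal D_H)=\mathcal D_H^2-2s_0\mathcal D_H+|s|^2$. A Poincaré constant of $\Omega$ is a number $C_P>0$ such that $\|F\|_2\le C_P\|F\|_D$ for all $F\in H^1_0(\Omega)$. Such a constant exists. Let $C_P$ be any Poincaré constant of $\Omega$,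 and let $s$ be a paravector such that $$K_{P,n,m,M}(s):=m^2-C_PM\Big(2(1+\alpha_n)+\sqrt n\,\sqrt{1+4s_0^2}\Big)-\Big|\big||s|^2-\beta_n\big|-\alpha_n\sqrt{1+4s_0^2}\Big|\,C_P^2>0$$ (the case $|s|^2=\beta_n$ is allowed). Then for every $f\in L^2(\Omega)$ there is a unique $F_f\in H^1_0(\Omega)$ with $$q_s(F_f,G)=\langle f,G\rangle_2\qquad\text{for all }G\in H^1_0(\Omega),$$ and this solution, denoted $Q_s(\mathcal D_H)^{-1}f:=F_f$, satisfies $$\|Q_s(\mathcal D_H)^{-1}f\|_D\le\frac{C_P}{K_{P,n,m,M}(s)}\|f\|_2,\qquad \|Q_s(\mathcal D_H)^{-1}f\|_2\le\frac{C_P^2}{K_{P,n,m,M}(s)}\|f\|_2 .$$ -/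

import Mathlib

open MeasureTheory
open scoped ContDiff

/-- The real Clifford algebra `ℝ_n` with `e_i² = -1`, as the space of coefficient families `(x_A)`
over the subsets `A` of the index set, with the norm `|x| = (∑_A x_A²)^{1/2}`. Its product is defined
below; `Cl.ofClifford_bijective` identifies it with Mathlib's `CliffordAlgebra`. -/
abbrev Cl (n : ℕ) : Type := EuclideanSpace ℝ (Finset (Fin n))

namespace Cl
variable {n : ℕ}

/-- The basis vector `e_A = e_{i_1} ⋯ e_{i_r}` for `A = {i_1 < ⋯ < i_r}`; see `basis_insert`. -/
noncomputable def basis (A : Finset (Fin n)) : Cl n := EuclideanSpace.single A 1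

/-- The sign with `e_A e_B = sgn A B • e_{A ∆ B}`: one factor `-1` for each pair `a > b` that is
interchanged and one for each `a = b` that is contracted by `e_a² = -1`. -/
def sgn (A B : Finset (Fin n)) : ℝ := (-1) ^ ((A ×ˢ B).filter (fun p => p.2 ≤ p.1)).card

theorem sgn_eq_prod (A B : Finset (Fin n)) :
    sgn A B = ∏ a ∈ A, ∏ b ∈ B, (if b ≤ a then (-1 : ℝ) else 1) := by
  rw [sgn, ← Finset.prod_product', Finset.prod_ite]
  simp

theorem prod_symmDiff {f : Fin n → ℝ} (hf : ∀ i, f i * f i = 1) (A B : Finset (Fin n)) :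
    ∏ i ∈ symmDiff A B, f i = (∏ i ∈ A, f i) * ∏ i ∈ B, f i := by
  have h : ∀ S : Finset (Fin n), ∏ i ∈ S, f i = ∏ i, (if i ∈ S then f i else 1) := by
    intro S; simp
  rw [h, h A, h B, ← Finset.prod_mul_distrib]
  refine Finset.prod_congr rfl fun i _ => ?_
  have := hf i
  by_cases hA : i ∈ A <;> by_cases hB : i ∈ B <;> simp [Finset.mem_symmDiff, hA, hB, this]

theorem sgn_symmDiff_left (A A' B : Finset (Fin n)) :
    sgn (symmDiff A A') B = sgn A B * sgn A' B := by
  simp only [sgn_eq_prod]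
  refine prod_symmDiff (fun i => ?_) A A'
  rw [← Finset.prod_mul_distrib]
  exact Finset.prod_eq_one fun j _ => by split_ifs <;> norm_num

theorem sgn_symmDiff_right (A B B' : Finset (Fin n)) :
    sgn A (symmDiff B B') = sgn A B * sgn A B' := by
  simp only [sgn_eq_prod, ← Finset.prod_mul_distrib]
  refine Finset.prod_congr rfl fun a _ => prod_symmDiff (fun i => ?_) B B'
  split_ifs <;> norm_num

noncomputable instance : Mul (Cl n) :=
  ⟨fun x y => ∑ A, ∑ B, (x A * y B * sgn A B) • basis (symmDiff A B)⟩

noncomputable instance : One (Cl n) := ⟨basis ∅⟩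

theorem mul_def (x y : Cl n) :
    x * y = ∑ A, ∑ B, (x A * y B * sgn A B) • basis (symmDiff A B) := rfl

theorem one_def : (1 : Cl n) = basis ∅ := rfl

theorem basis_mul_basis (A B : Finset (Fin n)) :
    basis A * basis B = sgn A B • basis (symmDiff A B) := by
  rw [mul_def, Finset.sum_eq_single A, Finset.sum_eq_single B] <;>
    simp +contextual [basis]

theorem eq_sum_basis (x : Cl n) : x = ∑ A, x A • basis A := by
  ext B
  simp [basis, Pi.single_apply]

theorem mul_add' (x y z : Cl n) : x * (y + z) = x * y + x * z := by
  simp only [mul_def, PiLp.add_apply, mul_add, add_mul, add_smul, Finset.sum_add_distrib]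

theorem add_mul' (x y z : Cl n) : (x + y) * z = x * z + y * z := by
  simp only [mul_def, PiLp.add_apply, add_mul, add_smul, Finset.sum_add_distrib]

theorem smul_mul' (c : ℝ) (x y : Cl n) : (c • x) * y = c • (x * y) := by
  simp only [mul_def, PiLp.smul_apply, smul_eq_mul, Finset.smul_sum, smul_smul, mul_assoc]

theorem mul_smul' (c : ℝ) (x y : Cl n) : x * (c • y) = c • (x * y) := by
  simp only [mul_def, PiLp.smul_apply, smul_eq_mul, Finset.smul_sum, smul_smul, mul_assoc,
    mul_left_comm c]


theorem induction {p : Cl n → Prop} (hadd : ∀ x y, p x → p y → p (x + y))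
    (hbasis : ∀ (c : ℝ) A, p (c • basis A)) (x : Cl n) : p x := by
  have h0 : p 0 := by simpa using hbasis 0 ∅
  rw [eq_sum_basis x]
  exact Finset.sum_induction _ p hadd h0 fun A _ => hbasis _ A

theorem mul_assoc' (x y z : Cl n) : x * y * z = x * (y * z) := by
  induction x using Cl.induction with
  | hadd x x' h h' => rw [add_mul', add_mul', add_mul', h, h']
  | hbasis a A =>
    induction y using Cl.induction with
    | hadd y y' h h' => rw [mul_add', add_mul', add_mul', mul_add', h, h']
    | hbasis b B =>
      induction z using Cl.induction with
      | hadd z z' h h' => rw [mul_add', mul_add', mul_add', h, h']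
      | hbasis c C =>
        simp only [smul_mul', mul_smul', basis_mul_basis, smul_smul, sgn_symmDiff_left,
          sgn_symmDiff_right, symmDiff_assoc]
        congr 1
        ring

theorem one_mul' (x : Cl n) : 1 * x = x := by
  induction x using Cl.induction with
  | hadd x y hx hy => rw [mul_add', hx, hy]
  | hbasis c A => simp [one_def, mul_smul', basis_mul_basis, sgn, show symmDiff ∅ A = A from bot_symmDiff A]

theorem mul_one' (x : Cl n) : x * 1 = x := by
  induction x using Cl.induction with
  | hadd x y hx hy => rw [add_mul', hx, hy]
  | hbasis c A => simp [one_def, smul_mul', basis_mul_basis, sgn, show symmDiff A ∅ = A from symmDiff_bot A]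

noncomputable instance : Ring (Cl n) :=
  { (inferInstance : AddCommGroup (Cl n)) with
    mul := (· * ·)
    one := 1
    left_distrib := mul_add'
    right_distrib := add_mul'
    zero_mul := fun x => by simpa using smul_mul' 0 0 x
    mul_zero := fun x => by simpa using mul_smul' 0 x 0
    mul_assoc := mul_assoc'
    one_mul := one_mul'
    mul_one := mul_one' }

noncomputable instance : Algebra ℝ (Cl n) := Algebra.ofModule smul_mul' mul_smul'

/-- The imaginary unit `e_i`. -/
noncomputable def e (i : Fin n) : Cl n := basis {i}

theorem e_mul_self (i : Fin n) : e i * e i = -1 := by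
  simp [e, basis_mul_basis, one_def, sgn, Finset.filter_singleton]

theorem e_mul_e {i j : Fin n} (h : i ≠ j) : e i * e j = -(e j * e i) := by
  rcases lt_or_gt_of_ne h with h | h <;>
  simp [e, basis_mul_basis, sgn, Finset.filter_singleton, h.le, h.not_ge, symmDiff_comm {i} {j}]

/-- `e_A` is the ordered product of units: adjoining a largest index multiplies on the right. -/
theorem basis_insert (A : Finset (Fin n)) (i : Fin n) (h : ∀ a ∈ A, a < i) :
    basis (insert i A) = basis A * e i := by
  have hi : i ∉ A := fun hi => lt_irrefl _ (h i hi)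
  have h1 : symmDiff A {i} = insert i A := by
    ext a
    by_cases ha : a = i <;> simp [Finset.mem_symmDiff, ha, hi]
  have h2 : ((A ×ˢ {i}).filter (fun p => p.2 ≤ p.1)) = ∅ := by
    ext ⟨a, b⟩
    simp only [Finset.mem_filter, Finset.mem_product, Finset.mem_singleton, Finset.notMem_empty,
      iff_false]
    rintro ⟨⟨ha, rfl⟩, hb⟩
    exact absurd (h a ha) (not_lt.mpr hb)
  rw [e, basis_mul_basis, h1, sgn, h2]
  simp

/-- Clifford conjugation: the linear map with `e_A ↦ (-1)^{r(r+1)/2} e_A`, `r = |A|`. It reverses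
products (`conj_mul`) and sends `e_i` to `-e_i` (`conj_e`). -/
noncomputable def conj (x : Cl n) : Cl n :=
  ∑ A, ((-1 : ℝ) ^ (A.card * (A.card + 1) / 2) * x A) • basis A

theorem sgn_self (A : Finset (Fin n)) : sgn A A = (-1) ^ (A.card * (A.card + 1) / 2) := by
  rw [sgn_eq_prod]
  induction A using Finset.induction_on_max with
  | empty => simp
  | insert i A hi ih =>
    have hn : i ∉ A := fun h => lt_irrefl _ (hi i h)
    have h1 : ∀ a ∈ A, (∏ b ∈ insert i A, if b ≤ a then (-1 : ℝ) else 1)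
        = ∏ b ∈ A, if b ≤ a then (-1 : ℝ) else 1 := by
      intro a ha
      rw [Finset.prod_insert hn, if_neg (not_le.mpr (hi a ha)), one_mul]
    have h2 : (∏ b ∈ insert i A, if b ≤ i then (-1 : ℝ) else 1) = (-1) ^ (A.card + 1) := by
      rw [Finset.prod_congr rfl (g := fun _ => (-1 : ℝ))]
      · simp [hn]
      · intro b hb
        rcases Finset.mem_insert.1 hb with rfl | hb
        · simp
        · simp [(hi b hb).le]
    rw [Finset.prod_insert hn, h2, Finset.prod_congr rfl h1, ih, Finset.card_insert_of_notMem hn,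
      ← pow_add]
    congr 1
    have : (A.card + 1) * (A.card + 1 + 1) = A.card * (A.card + 1) + (A.card + 1) * 2 := by ring
    rw [this, Nat.add_mul_div_right _ _ (by norm_num)]
    ring

theorem conj_basis (A : Finset (Fin n)) : conj (basis A) = sgn A A • basis A := by
  rw [conj, Finset.sum_eq_single A]
  · simp [sgn_self, basis]
  · intro B _ h
    simp [basis, h]
  · simp

theorem conj_add (x y : Cl n) : conj (x + y) = conj x + conj y := by
  simp [conj, mul_add, add_smul, Finset.sum_add_distrib]

theorem conj_smul (c : ℝ) (x : Cl n) : conj (c • x) = c • conj x := by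
  simp [conj, Finset.smul_sum, smul_smul, mul_left_comm]

theorem conj_e (i : Fin n) : conj (e i) = -e i := by
  simp [e, conj_basis, sgn, Finset.filter_singleton]

theorem conj_one : conj (1 : Cl n) = 1 := by simp [one_def, conj_basis, sgn]

theorem conj_mul (x y : Cl n) : conj (x * y) = conj y * conj x := by
  have hs : ∀ A B : Finset (Fin n), sgn A B * sgn A B = 1 := fun A B => by
    rw [sgn, ← mul_pow]; norm_num
  induction x using Cl.induction with
  | hadd x x' h h' => rw [add_mul, conj_add, conj_add, mul_add, h, h']
  | hbasis a A =>
    induction y using Cl.induction with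
    | hadd y y' h h' => rw [mul_add, conj_add, conj_add, add_mul, h, h']
    | hbasis b B =>
      simp only [smul_mul', mul_smul', basis_mul_basis, conj_smul, conj_basis, smul_smul,
        sgn_symmDiff_left, sgn_symmDiff_right, symmDiff_comm B A]
      congr 1
      linear_combination (a * b * sgn A A * sgn B A * sgn B B) * hs A B

/-- The scalar part `x_∅`. -/
def Sc (x : Cl n) : ℝ := x ∅

/-- The Euclidean inner product of the coefficients is `Sc (conj x * y)`. -/
theorem Sc_conj_mul (x y : Cl n) : Sc (conj x * y) = inner ℝ x y := by
  have hs : ∀ A B : Finset (Fin n), sgn A B * sgn A B = 1 := fun A B => by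
    rw [sgn, ← mul_pow]; norm_num
  have hadd : ∀ x y : Cl n, Sc (x + y) = Sc x + Sc y := fun x y => rfl
  have hsm : ∀ (c : ℝ) (x : Cl n), Sc (c • x) = c * Sc x := fun c x => rfl
  induction x using Cl.induction with
  | hadd x x' h h' => rw [conj_add, add_mul, hadd, h, h', inner_add_left]
  | hbasis a A =>
    induction y using Cl.induction with
    | hadd y y' h h' => rw [mul_add, hadd, h, h', inner_add_right]
    | hbasis b B =>
      simp only [smul_mul', mul_smul', basis_mul_basis, conj_smul, conj_basis, hsm,
        inner_smul_left, inner_smul_right]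
      by_cases h : A = B
      · subst h
        have : Sc (basis (n := n) ∅) = 1 := by simp [Sc, basis]
        simp [hs, this]
        simp [basis]
      · have h1 : symmDiff A B ≠ ∅ := fun h' => h (symmDiff_eq_bot.1 h')
        have : Sc (basis (symmDiff A B)) = 0 := by simp [Sc, basis, h1.symm]
        simp [this]
        simp [basis, EuclideanSpace.inner_single_left, h]

/-- The vector `∑ v_i e_i`. -/
noncomputable def vec : (Fin n → ℝ) →ₗ[ℝ] Cl n := Fintype.linearCombination ℝ e

/-- The quadratic form `v ↦ -∑ v_i²`. -/
noncomputable abbrev negQ (n : ℕ) : QuadraticForm ℝ (Fin n → ℝ) :=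
  QuadraticMap.weightedSumSquares ℝ (fun _ : Fin n => (-1 : ℝ))


theorem vec_mul_self (v : Fin n → ℝ) : vec v * vec v = algebraMap ℝ (Cl n) (negQ n v) := by
  have hc : ∀ i j, e i * e j + e j * e i = algebraMap ℝ (Cl n) (if i = j then -2 else 0) := by
    intro i j
    by_cases h : i = j
    · subst h
      rw [e_mul_self, if_pos rfl, map_neg, map_ofNat]
      norm_num
    · rw [e_mul_e h, if_neg h, map_zero]; simp
  have h1 : vec v * vec v = ∑ i, ∑ j, (v i * v j) • (e i * e j) := by
    simp only [vec, Fintype.linearCombination_apply, Finset.sum_mul_sum, smul_mul_smul_comm]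
  have h2 : vec v * vec v = ∑ i, ∑ j, (v i * v j) • (e j * e i) := by
    rw [h1, Finset.sum_comm]
    simp only [mul_comm]
  have h3 : (2 : ℝ) • (vec v * vec v) = (2 : ℝ) • algebraMap ℝ (Cl n) (negQ n v) := by
    rw [two_smul]
    nth_rewrite 1 [h1]
    rw [h2, ← Finset.sum_add_distrib]
    simp only [← Finset.sum_add_distrib, ← smul_add, hc, Algebra.algebraMap_eq_smul_one, smul_smul]
    simp [QuadraticMap.weightedSumSquares_apply, Finset.mul_sum, ← Finset.sum_smul]
    congr 1
    funext i
    ring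
  exact smul_right_injective _ two_ne_zero h3

/-- The algebra map from Mathlib's Clifford algebra of `-∑ v_i²` that sends `ι v` to `∑ v_i e_i`. -/
noncomputable def ofClifford : CliffordAlgebra (negQ n) →ₐ[ℝ] Cl n :=
  CliffordAlgebra.lift (negQ n) ⟨vec, vec_mul_self⟩

theorem ofClifford_bijective : Function.Bijective (ofClifford (n := n)) := by
  have he : ∀ i : Fin n, e i ∈ (ofClifford (n := n)).range := fun i =>
    ⟨CliffordAlgebra.ι _ (Pi.single i 1), by
      simp [ofClifford, vec, Fintype.linearCombination_apply, Pi.single_apply]⟩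
  have hb : ∀ A : Finset (Fin n), basis A ∈ (ofClifford (n := n)).range := by
    intro A
    induction A using Finset.induction_on_max with
    | empty => exact one_mem _
    | insert i A hi ih => rw [basis_insert A i hi]; exact mul_mem ih (he i)
  have hr : Function.Surjective (ofClifford (n := n)) := fun x => by
    rw [eq_sum_basis x]
    exact sum_mem fun A _ => Subalgebra.smul_mem _ (hb A) _
  have b := ((Pi.basisFun ℝ (Fin n)).ExteriorAlgebra).map
    (CliffordAlgebra.equivExterior (negQ n)).symm
  have : FiniteDimensional ℝ (CliffordAlgebra (negQ n)) := b.finiteDimensional_of_finite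
  have hd : Module.finrank ℝ (CliffordAlgebra (negQ n)) = Module.finrank ℝ (Cl n) := by
    rw [Module.finrank_eq_card_basis b, finrank_euclideanSpace]
  exact ⟨(LinearMap.injective_iff_surjective_of_finrank_eq_finrank hd
    (f := (ofClifford (n := n)).toLinearMap)).2 hr, hr⟩

end Cl

/-- Points of `ℝⁿ`. -/
abbrev Pt (n : ℕ) : Type := EuclideanSpace ℝ (Fin n)

/-- `L²(Ω, ℝ_n)` for Lebesgue measure; its norm is `‖F‖₂ = (∫_Ω Sc (conj F * F))^{1/2}`. -/
abbrev L2 {n : ℕ} (Ω : Set (Pt n)) : Type := Lp (Cl n) 2 (volume.restrict Ω)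

/-- The `ℝ_n`-valued inner product `⟨F, G⟩₂ = ∫_Ω conj F * G`. -/
noncomputable def cinner {n : ℕ} (Ω : Set (Pt n)) (F G : Pt n → Cl n) : Cl n :=
  ∫ x in Ω, Cl.conj (F x) * G x

/-- `φ ∈ C_c^∞(Ω, V)`. -/
def IsTestFunction {n : ℕ} {V : Type*} [NormedAddCommGroup V] [NormedSpace ℝ V]
    (Ω : Set (Pt n)) (φ : Pt n → V) : Prop :=
  ContDiff ℝ ∞ φ ∧ HasCompactSupport φ ∧ tsupport φ ⊆ Ω

/-- `G` is the weak partial derivative `∂_{x_i} F` on `Ω`. -/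
def HasWeakPartial {n : ℕ} (Ω : Set (Pt n)) (i : Fin n) (F G : L2 Ω) : Prop :=
  ∀ φ : Pt n → ℝ, IsTestFunction Ω φ →
    ∫ x in Ω, (fderiv ℝ φ x (EuclideanSpace.single i 1)) • F x = -∫ x in Ω, φ x • G x

/-- The Sobolev space `H¹(Ω, ℝ_n)`, as a subset of `L²(Ω, ℝ_n)`. -/
def H1 {n : ℕ} (Ω : Set (Pt n)) : Set (L2 Ω) :=
  {F | ∀ i, ∃ G, HasWeakPartial Ω i F G}

open Classical in
/-- The weak partial derivative `∂_{x_i} F`; it is unique when it exists and `Ω` is open, and the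
value `0` is assigned when it does not exist. -/
noncomputable def wderiv {n : ℕ} (Ω : Set (Pt n)) (i : Fin n) (F : L2 Ω) : L2 Ω :=
  if h : ∃ G, HasWeakPartial Ω i F G then h.choose else 0

/-- The seminorm `‖F‖_D = (∑_i ‖∂_{x_i} F‖₂²)^{1/2}` on `H¹`. -/
noncomputable def dNorm {n : ℕ} (Ω : Set (Pt n)) (F : L2 Ω) : ℝ :=
  √(∑ i, ‖wderiv Ω i F‖ ^ 2)

/-- The `H¹` norm `(‖F‖₂² + ‖F‖_D²)^{1/2}`. -/
noncomputable def h1Norm {n : ℕ} (Ω : Set (Pt n)) (F : L2 Ω) : ℝ :=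
  √(‖F‖ ^ 2 + dNorm Ω F ^ 2)

/-- `H¹₀(Ω, ℝ_n)`: the closure of `C_c^∞(Ω, ℝ_n)` in `H¹(Ω, ℝ_n)`. -/
def H10 {n : ℕ} (Ω : Set (Pt n)) : Set (L2 Ω) :=
  {F | F ∈ H1 Ω ∧ ∀ ε > 0, ∃ φ : Pt n → Cl n, IsTestFunction Ω φ ∧
    ∃ Φ : L2 Ω, Φ =ᵐ[volume.restrict Ω] φ ∧ h1Norm Ω (F - Φ) < ε}

/-- `C` is a Poincaré constant of `Ω`. -/
def IsPoincareConstant {n : ℕ} (Ω : Set (Pt n)) (C : ℝ) : Prop :=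
  0 < C ∧ ∀ F ∈ H10 Ω, ‖F‖ ≤ C * dNorm Ω F

/-- `α_n = (n - 1) / 2`. -/
noncomputable def alphaC (n : ℕ) : ℝ := ((n : ℝ) - 1) / 2

/-- `β_n = α_n + α_n²`. -/
noncomputable def betaC (n : ℕ) : ℝ := alphaC n + alphaC n ^ 2

/-- The last coordinate `y` of `(x_1, …, x_d, y) ∈ ℝ^{d+1}`. -/
def height {d : ℕ} (x : Pt (d + 1)) : ℝ := x (Fin.last d)

/-- The hyperbolic Dirac operator on `H¹(Ω, ℝ_n)`, `n = d + 1`: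
`D_H F = ∑_{i<n} e_i y ∂_{x_i} F - α_n e_n F + e_n y ∂_y F`. -/
noncomputable def diracH {d : ℕ} (Ω : Set (Pt (d + 1))) (F : L2 Ω) (x : Pt (d + 1)) :
    Cl (d + 1) :=
  (∑ i : Fin d, Cl.e i.castSucc * (height x • wderiv Ω i.castSucc F x))
    - alphaC (d + 1) • (Cl.e (Fin.last d) * F x)
    + Cl.e (Fin.last d) * (height x • wderiv Ω (Fin.last d) F x)

/-- The sesquilinear form `q_s` of the Dirichlet problem for
`Q_s(D_H) = D_H² - 2 s_0 D_H + |s|²`. The paravector `s = s_0 + s_1 e_1 + ⋯ + s_n e_n` is given by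
its coordinates: `s 0` is the real part, `‖s‖` is the modulus. -/
noncomputable def qForm {d : ℕ} (Ω : Set (Pt (d + 1))) (s : EuclideanSpace ℝ (Fin (d + 2)))
    (F G : L2 Ω) : Cl (d + 1) :=
  (∑ i : Fin d, cinner Ω (fun x => height x ^ 2 • wderiv Ω i.castSucc F x)
      (wderiv Ω i.castSucc G))
    + cinner Ω (fun x => height x ^ 2 • wderiv Ω (Fin.last d) F x) (wderiv Ω (Fin.last d) G)
    + (2 * (1 + alphaC (d + 1))) •
        cinner Ω (fun x => height x • wderiv Ω (Fin.last d) F x) G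
    + cinner Ω (fun x => (Cl.e (Fin.last d) - algebraMap ℝ (Cl (d + 1)) (2 * s 0))
        * diracH Ω F x) G
    + cinner Ω (fun x => (‖s‖ ^ 2 - betaC (d + 1)) • F x) G

/-- `F ∈ H¹₀` is a weak solution of `Q_s(D_H) F = f` in `Ω`, `F = 0` on `∂Ω`. -/
def IsWeakSolution {d : ℕ} (Ω : Set (Pt (d + 1))) (s : EuclideanSpace ℝ (Fin (d + 2)))
    (f F : L2 Ω) : Prop :=
  F ∈ H10 Ω ∧ ∀ G ∈ H10 Ω, qForm Ω s F G = cinner Ω f G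

/-- The constant `K_{P,n,m,M}(s)`, for the Poincaré constant `C`. -/
noncomputable def KP (n : ℕ) (m M C : ℝ) (s : EuclideanSpace ℝ (Fin (n + 1))) : ℝ :=
  m ^ 2 - C * M * (2 * (1 + alphaC n) + √n * √(1 + 4 * s 0 ^ 2))
    - |(|‖s‖ ^ 2 - betaC n|) - alphaC n * √(1 + 4 * s 0 ^ 2)| * C ^ 2

/-! ### Scalar parts and multiplication operators in the Clifford algebra -/

namespace Cl
variable {n : ℕ}

/-! The proof is Lax–Milgram for a real bilinear form. Since H¹₀ is stable under right
multiplication by constants, the Clifford-valued equation is equivalent to its scalar part, tested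
with all G e_A (`Cl.eq_of_Sc_mul_basis`, `isWeakSolution_iff`). Functions are replaced by their jets
(F, ∂₁F, …, ∂ₙF): the closure of the jets of test functions is a closed subspace of a Hilbert space,
corresponds exactly to H¹₀, and carries the form as a bounded bilinear map.

Coercivity is `KP_mul_dNorm_sq_le`. Write D = ‖F‖_D, N = ‖F‖₂ and α = α_n. The principal part is at
least m²D². Integration by parts gives Sc⟨y∂_yF, F⟩ = -N²/2, and e_n² = -1 gives Sc⟨(e_n - 2s₀)(-α
e_n F), F⟩ = αN². So these terms and the potential add up exactly to (|s|² - β_n - 1)N², with no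
estimate needed (`inner_lowerOrder_self`). What remains is the derivative part of the Dirac
operator, bounded by √(1+4s₀²)·M√n·D·N.

The coefficient of N² is at least -(1+α+α²). Positivity of K forces 2(1+α)C_P ≤ M, hence
C_P²(1+α+α²) ≤ 2(1+α)C_P M, so this loss is covered by a term already in K. The absolute value in K
is only ever discarded as nonnegative. Both norm bounds then follow by testing with the solution
itself. -/

theorem sgn_mul_self (A B : Finset (Fin n)) : sgn A B * sgn A B = 1 := by
  rw [sgn, ← mul_pow]; norm_num

theorem Sc_mul_basis (x : Cl n) (A : Finset (Fin n)) : Sc (x * basis A) = x A * sgn A A := by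
  induction x using Cl.induction with
  | hadd x y hx hy =>
    rw [add_mul]
    change Sc (x * basis A) + Sc (y * basis A) = (x A + y A) * sgn A A
    rw [hx, hy, add_mul]
  | hbasis c B =>
    rw [smul_mul', basis_mul_basis]
    change c * (sgn B A * basis (symmDiff B A) ∅) = c * basis B A * sgn A A
    by_cases h : B = A
    · subst h
      simp [basis]
    · have h1 : symmDiff B A ≠ ∅ := fun h' => h (symmDiff_eq_bot.1 h')
      simp [basis, h1.symm, Ne.symm h]

/-- The product e_B e_A has a scalar part only when B = A, so the scalar part of x e_A is x_A up to
sign. This turns one algebra-valued equation into finitely many real ones. -/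
theorem eq_of_Sc_mul_basis {x y : Cl n} (h : ∀ A, Sc (x * basis A) = Sc (y * basis A)) :
    x = y := by
  ext A
  have h1 := h A
  rw [Sc_mul_basis, Sc_mul_basis] at h1
  have h2 : sgn A A ≠ 0 := fun h0 => by simpa [h0] using sgn_mul_self A A
  exact mul_right_cancel₀ h2 h1

/-- Conjugation is the adjoint for the coefficient inner product, and e_i is conjugated to -e_i;
left multiplication by a unit is therefore skew-adjoint. -/
theorem inner_e_mul (i : Fin n) (x y : Cl n) : inner ℝ (e i * x) y = -inner ℝ x (e i * y) := by
  have hneg : ∀ x : Cl n, Sc (-x) = -Sc x := fun _ => rfl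
  rw [← Sc_conj_mul, ← Sc_conj_mul, conj_mul, conj_e, ← hneg]
  congr 1
  noncomm_ring

/-- Left multiplication by `a` as a continuous linear map. -/
noncomputable def mulL (a : Cl n) : Cl n →L[ℝ] Cl n :=
  LinearMap.toContinuousLinearMap (LinearMap.mulLeft ℝ a)

/-- Right multiplication by `a` as a continuous linear map. -/
noncomputable def mulR (a : Cl n) : Cl n →L[ℝ] Cl n :=
  LinearMap.toContinuousLinearMap (LinearMap.mulRight ℝ a)

@[simp] theorem mulL_apply (a x : Cl n) : mulL a x = a * x := rfl

@[simp] theorem mulR_apply (a x : Cl n) : mulR a x = x * a := rfl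

/-- The scalar part as a continuous linear functional. -/
noncomputable def ScL : Cl n →L[ℝ] ℝ := EuclideanSpace.proj ∅

@[simp] theorem ScL_apply (x : Cl n) : ScL x = Sc x := rfl

/-- The product `conj x * y` as a continuous bilinear map. -/
noncomputable def conjMulL : Cl n →L[ℝ] Cl n →L[ℝ] Cl n :=
  (LinearMap.mk₂ ℝ (fun x y : Cl n => conj x * y)
    (fun x x' y => by rw [conj_add, add_mul])
    (fun c x y => by rw [conj_smul, smul_mul'])
    (fun x y y' => mul_add _ _ _)
    (fun c x y => mul_smul' _ _ _)).toContinuousBilinearMap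

@[simp] theorem conjMulL_apply (x y : Cl n) : conjMulL x y = conj x * y := rfl

end Cl

/-! ### Clifford multiplication and the algebra-valued pairing on L² -/

section L2Operators
variable {n : ℕ} {Ω : Set (Pt n)}

/-- Left multiplication by `a` on `L²(Ω)`. -/
noncomputable def L2.mulL (a : Cl n) : L2 Ω →L[ℝ] L2 Ω :=
  (Cl.mulL a).compLpL 2 (volume.restrict Ω)

/-- Right multiplication by `a` on `L²(Ω)`. -/
noncomputable def L2.mulR (a : Cl n) : L2 Ω →L[ℝ] L2 Ω :=
  (Cl.mulR a).compLpL 2 (volume.restrict Ω)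

theorem L2.coeFn_mulL (a : Cl n) (F : L2 Ω) :
    L2.mulL a F =ᵐ[volume.restrict Ω] fun x => a * F x :=
  (Cl.mulL a).coeFn_compLpL F

theorem L2.coeFn_mulR (a : Cl n) (F : L2 Ω) :
    L2.mulR a F =ᵐ[volume.restrict Ω] fun x => F x * a :=
  (Cl.mulR a).coeFn_compLpL F

theorem L2.inner_mulL_e (i : Fin n) (F G : L2 Ω) :
    inner ℝ (L2.mulL (Cl.e i) F) G = -inner ℝ F (L2.mulL (Cl.e i) G) := by
  rw [L2.inner_def, L2.inner_def, ← integral_neg]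
  refine integral_congr_ae ?_
  filter_upwards [L2.coeFn_mulL (Cl.e i) F, L2.coeFn_mulL (Cl.e i) G] with x h1 h2
  rw [h1, h2, Cl.inner_e_mul]

theorem L2.mulL_e_mulL_e (i : Fin n) (F : L2 Ω) :
    L2.mulL (Cl.e i) (L2.mulL (Cl.e i) F) = -F := by
  refine Lp.ext ?_
  filter_upwards [L2.coeFn_mulL (Cl.e i) F, L2.coeFn_mulL (Cl.e i) (L2.mulL (Cl.e i) F),
    Lp.coeFn_neg F] with x h1 h2 h3
  rw [h2, h1, h3, ← mul_assoc, Cl.e_mul_self, neg_one_mul, Pi.neg_apply]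

theorem L2.inner_mulL_e_self (i : Fin n) (F : L2 Ω) : inner ℝ (L2.mulL (Cl.e i) F) F = 0 := by
  have h := L2.inner_mulL_e i F F
  rw [real_inner_comm (L2.mulL (Cl.e i) F) F] at h
  linarith

theorem L2.norm_mulL_e (i : Fin n) (F : L2 Ω) : ‖L2.mulL (Cl.e i) F‖ = ‖F‖ := by
  have h := L2.inner_mulL_e i F (L2.mulL (Cl.e i) F)
  rw [L2.mulL_e_mulL_e, inner_neg_right, neg_neg, real_inner_self_eq_norm_sq,
    real_inner_self_eq_norm_sq] at h
  exact (pow_left_inj₀ (norm_nonneg _) (norm_nonneg _) two_ne_zero).1 h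

/-- Left multiplication by `e_i - c`. -/
noncomputable def L2.mulESub (i : Fin n) (c : ℝ) : L2 Ω →L[ℝ] L2 Ω :=
  L2.mulL (Cl.e i) - c • ContinuousLinearMap.id ℝ (L2 Ω)

theorem L2.mulESub_apply (i : Fin n) (c : ℝ) (F : L2 Ω) :
    L2.mulESub i c F = L2.mulL (Cl.e i) F - c • F := rfl

theorem L2.coeFn_mulESub (i : Fin n) (c : ℝ) (F : L2 Ω) :
    L2.mulESub i c F =ᵐ[volume.restrict Ω]
      fun x => (Cl.e i - algebraMap ℝ (Cl n) c) * F x := by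
  rw [L2.mulESub_apply]
  filter_upwards [Lp.coeFn_sub (L2.mulL (Cl.e i) F) (c • F), Lp.coeFn_smul c F,
    L2.coeFn_mulL (Cl.e i) F] with x h1 h2 h3
  rw [h1, Pi.sub_apply, h2, h3, Pi.smul_apply, sub_mul, Algebra.smul_def]

/-- Left multiplication by e_i is isometric and skew, so the cross term vanishes and Pythagoras
gives an equality. With c = 2s₀ this is the source of √(1+4s₀²) in K. -/
theorem L2.norm_mulESub (i : Fin n) (c : ℝ) (F : L2 Ω) :
    ‖L2.mulESub i c F‖ = √(1 + c ^ 2) * ‖F‖ := by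
  rw [← pow_left_inj₀ (norm_nonneg _) (by positivity) two_ne_zero, mul_pow,
    Real.sq_sqrt (by positivity), L2.mulESub_apply, norm_sub_sq_real, L2.norm_mulL_e,
    inner_smul_right, L2.inner_mulL_e_self, norm_smul, mul_pow, Real.norm_eq_abs, sq_abs]
  ring

theorem integrable_conj_mul (F G : L2 Ω) :
    Integrable (fun x => Cl.conj (F x) * G x) (volume.restrict Ω) := by
  exact memLp_one_iff_integrable.1
    ((Cl.conjMulL (n := n)).memLp_of_bilin 1 (Lp.memLp F) (Lp.memLp G))

theorem cinner_congr {F F' G G' : Pt n → Cl n} (hF : F =ᵐ[volume.restrict Ω] F')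
    (hG : G =ᵐ[volume.restrict Ω] G') : cinner Ω F G = cinner Ω F' G' := by
  refine integral_congr_ae ?_
  filter_upwards [hF, hG] with x h1 h2
  rw [h1, h2]

/-- By associativity the constant a can be absorbed into the second argument, where it changes only
the test function. -/
theorem Sc_cinner_mul (F G : L2 Ω) (a : Cl n) :
    Cl.Sc (cinner Ω F G * a) = inner ℝ F (L2.mulR a G) := by
  have h : Cl.Sc (cinner Ω F G * a) = (Cl.ScL ∘L Cl.mulR a) (cinner Ω F G) := rfl
  rw [h, cinner, ← ContinuousLinearMap.integral_comp_comm _ (integrable_conj_mul F G),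
    L2.inner_def]
  refine integral_congr_ae ?_
  filter_upwards [L2.coeFn_mulR a G] with x h1
  rw [h1, ← Cl.Sc_conj_mul, ← mul_assoc]
  rfl

end L2Operators

/-! ### Test functions and their classical derivatives -/

section TestFunctions
variable {n : ℕ} {Ω : Set (Pt n)} {V : Type*} [NormedAddCommGroup V] [NormedSpace ℝ V]

/-- The classical partial derivative `∂_{x_i} φ`. -/
noncomputable def partialDeriv (i : Fin n) (φ : Pt n → V) (x : Pt n) : V :=
  fderiv ℝ φ x (EuclideanSpace.single i 1)

theorem IsTestFunction.differentiable {φ : Pt n → V} (h : IsTestFunction Ω φ) :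
    Differentiable ℝ φ :=
  h.1.differentiable (by simp)

theorem IsTestFunction.eq_zero_of_notMem {φ : Pt n → V} (h : IsTestFunction Ω φ) {x : Pt n}
    (hx : x ∉ Ω) : φ x = 0 :=
  image_eq_zero_of_notMem_tsupport fun hx' => hx (h.2.2 hx')

theorem IsTestFunction.deriv {φ : Pt n → V} (h : IsTestFunction Ω φ) (i : Fin n) :
    IsTestFunction Ω (partialDeriv i φ) := by
  refine ⟨?_, h.2.1.fderiv_apply ℝ _, (tsupport_fderiv_apply_subset ℝ _).trans h.2.2⟩
  exact (h.1.fderiv_right (m := ∞) (by simp)).clm_apply contDiff_const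

theorem IsTestFunction.memLp {φ : Pt n → V} (h : IsTestFunction Ω φ) :
    MemLp φ 2 (volume.restrict Ω) :=
  (h.1.continuous.memLp_of_hasCompactSupport h.2.1).restrict Ω

theorem IsTestFunction.setIntegral_smul_eq {W : Type*} [NormedAddCommGroup W] [NormedSpace ℝ W]
    {φ : Pt n → ℝ} (h : IsTestFunction Ω φ) (F : Pt n → W) :
    ∫ x in Ω, φ x • F x = ∫ x, φ x • F x :=
  setIntegral_eq_integral_of_forall_compl_eq_zero fun x hx => by
    rw [h.eq_zero_of_notMem hx, zero_smul]

theorem IsTestFunction.integrable_smul {φ : Pt n → ℝ} (h : IsTestFunction Ω φ) (F : L2 Ω) :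
    Integrable (fun x => φ x • F x) (volume.restrict Ω) :=
  memLp_one_iff_integrable.1 (MemLp.smul (Lp.memLp F) h.memLp)

/-- The class in `L²(Ω)` of a test function. -/
noncomputable def IsTestFunction.toL2 {φ : Pt n → Cl n} (h : IsTestFunction Ω φ) : L2 Ω :=
  h.memLp.toLp φ

theorem IsTestFunction.coeFn_toL2 {φ : Pt n → Cl n} (h : IsTestFunction Ω φ) :
    h.toL2 =ᵐ[volume.restrict Ω] φ :=
  h.memLp.coeFn_toLp

theorem IsTestFunction.add {φ ψ : Pt n → V} (h : IsTestFunction Ω φ)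
    (h' : IsTestFunction Ω ψ) : IsTestFunction Ω (φ + ψ) :=
  ⟨h.1.add h'.1, h.2.1.add h'.2.1,
    (tsupport_add φ ψ).trans (Set.union_subset h.2.2 h'.2.2)⟩

theorem IsTestFunction.clm_comp {W : Type*} [NormedAddCommGroup W] [NormedSpace ℝ W]
    {φ : Pt n → V} (h : IsTestFunction Ω φ) (T : V →L[ℝ] W) : IsTestFunction Ω (T ∘ φ) :=
  ⟨T.contDiff.comp h.1, h.2.1.comp_left (map_zero T),
    (tsupport_comp_subset (map_zero T) φ).trans h.2.2⟩

theorem IsTestFunction.zero : IsTestFunction Ω (0 : Pt n → V) :=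
  ⟨contDiff_const, HasCompactSupport.zero, by simp [tsupport]⟩

theorem partialDeriv_clm_comp {W : Type*} [NormedAddCommGroup W] [NormedSpace ℝ W]
    {φ : Pt n → V} (h : Differentiable ℝ φ) (T : V →L[ℝ] W) (i : Fin n) :
    partialDeriv i (T ∘ φ) = T ∘ partialDeriv i φ := by
  funext x
  simp only [partialDeriv, Function.comp_apply]
  rw [(T.hasFDerivAt.comp x (h x).hasFDerivAt).fderiv]
  rfl

theorem IsTestFunction.hasWeakPartial {φ : Pt n → Cl n} (h : IsTestFunction Ω φ) (i : Fin n) :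
    HasWeakPartial Ω i h.toL2 (h.deriv i).toL2 := by
  intro ψ hψ
  have h1 : ∫ x in Ω, fderiv ℝ ψ x (EuclideanSpace.single i 1) • h.toL2 x
      = ∫ x, partialDeriv i ψ x • φ x := by
    rw [← (hψ.deriv i).setIntegral_smul_eq]
    refine integral_congr_ae ?_
    filter_upwards [h.coeFn_toL2] with x hx
    rw [hx]; rfl
  have h2 : ∫ x in Ω, ψ x • (h.deriv i).toL2 x = ∫ x, ψ x • partialDeriv i φ x := by
    rw [← hψ.setIntegral_smul_eq]
    refine integral_congr_ae ?_
    filter_upwards [(h.deriv i).coeFn_toL2] with x hx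
    rw [hx]
  rw [h1, h2]
  have h3 := integral_smul_fderiv_eq_neg_fderiv_smul_of_integrable (μ := (volume : Measure (Pt n)))
    (f := ψ) (g := φ) (v := EuclideanSpace.single i 1)
    (((hψ.deriv i).1.continuous.smul h.1.continuous).integrable_of_hasCompactSupport
      h.2.1.smul_left)
    ((hψ.1.continuous.smul (h.deriv i).1.continuous).integrable_of_hasCompactSupport
      (h.deriv i).2.1.smul_left)
    ((hψ.1.continuous.smul h.1.continuous).integrable_of_hasCompactSupport h.2.1.smul_left)
    (fun x _ => hψ.differentiable x) (fun x _ => h.differentiable x)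
  simp only [partialDeriv]
  rw [h3, neg_neg]

end TestFunctions

/-! ### Uniqueness and closedness of weak derivatives -/

section WeakDerivatives
variable {n : ℕ} {Ω : Set (Pt n)} {i : Fin n} {F F' G G' : L2 Ω}

/-- This is the fundamental lemma of the calculus of variations, applied to the locally integrable
difference. It makes the value chosen in `wderiv` independent of the choice. -/
theorem HasWeakPartial.unique (hΩ : IsOpen Ω) (h : HasWeakPartial Ω i F G)
    (h' : HasWeakPartial Ω i F G') : G = G' := by
  rw [← sub_eq_zero]
  suffices h0 : ∀ᵐ x ∂volume.restrict Ω, (G - G') x = 0 by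
    refine Lp.ext ?_
    filter_upwards [h0, Lp.coeFn_zero (Cl n) 2 (volume.restrict Ω)] with x h1 h2
    rw [h1, h2, Pi.zero_apply]
  rw [ae_restrict_iff' hΩ.measurableSet]
  refine hΩ.ae_eq_zero_of_integral_contDiff_smul_eq_zero ?_ fun φ h1 h2 h3 => ?_
  · exact locallyIntegrableOn_of_locallyIntegrable_restrict
      ((Lp.memLp (G - G')).locallyIntegrable (by norm_num))
  · have hφ : IsTestFunction Ω φ := ⟨h1, h2, h3⟩
    rw [← hφ.setIntegral_smul_eq]
    have h4 : ∫ x in Ω, φ x • (G - G') x = ∫ x in Ω, (φ x • G x - φ x • G' x) := by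
      refine integral_congr_ae ?_
      filter_upwards [Lp.coeFn_sub G G'] with x hx
      rw [hx, Pi.sub_apply, smul_sub]
    rw [h4, integral_sub (hφ.integrable_smul G) (hφ.integrable_smul G'), sub_eq_zero,
      ← neg_inj, ← h φ hφ, ← h' φ hφ]

theorem HasWeakPartial.sub (h : HasWeakPartial Ω i F G) (h' : HasWeakPartial Ω i F' G') :
    HasWeakPartial Ω i (F - F') (G - G') := by
  intro φ hφ
  have key : ∀ (ψ : Pt n → ℝ), IsTestFunction Ω ψ → ∀ A B : L2 Ω,
      ∫ x in Ω, ψ x • (A - B) x = (∫ x in Ω, ψ x • A x) - ∫ x in Ω, ψ x • B x := by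
    intro ψ hψ A B
    rw [← integral_sub (hψ.integrable_smul A) (hψ.integrable_smul B)]
    refine integral_congr_ae ?_
    filter_upwards [Lp.coeFn_sub A B] with x hx
    rw [hx, Pi.sub_apply, smul_sub]
  have h1 := h φ hφ
  have h2 := h' φ hφ
  have h3 := key _ (hφ.deriv i) F F'
  simp only [partialDeriv] at h3
  rw [h3, key φ hφ, h1, h2]
  abel

theorem HasWeakPartial.wderiv_eq (hΩ : IsOpen Ω) (h : HasWeakPartial Ω i F G) :
    wderiv Ω i F = G := by
  have h' : ∃ G, HasWeakPartial Ω i F G := ⟨G, h⟩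
  rw [wderiv, dif_pos h']
  exact h'.choose_spec.unique hΩ h

theorem hasWeakPartial_wderiv (h : F ∈ H1 Ω) (i : Fin n) :
    HasWeakPartial Ω i F (wderiv Ω i F) := by
  rw [wderiv, dif_pos (h i)]
  exact (h i).choose_spec

theorem inner_toL2_smul_const {φ : Pt n → ℝ} (hφ : IsTestFunction Ω φ) (c : Cl n) (F : L2 Ω) :
    inner ℝ (hφ.clm_comp (ContinuousLinearMap.toSpanSingleton ℝ c)).toL2 F
      = inner ℝ c (∫ x in Ω, φ x • F x) := by
  rw [← integral_inner (hφ.integrable_smul F), L2.inner_def]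
  refine integral_congr_ae ?_
  filter_upwards [(hφ.clm_comp (ContinuousLinearMap.toSpanSingleton ℝ c)).coeFn_toL2] with x hx
  rw [hx]
  simp [inner_smul_left, inner_smul_right]

/-- Pairing the defining identity with every constant c, that is, testing with φc, writes the graph
as an intersection of equalizers of L²-continuous functionals. -/
theorem isClosed_hasWeakPartial (Ω : Set (Pt n)) (i : Fin n) :
    IsClosed {p : L2 Ω × L2 Ω | HasWeakPartial Ω i p.1 p.2} := by
  have h : {p : L2 Ω × L2 Ω | HasWeakPartial Ω i p.1 p.2}
      = ⋂ (φ : Pt n → ℝ) (hφ : IsTestFunction Ω φ) (c : Cl n),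
        {p : L2 Ω × L2 Ω |
          inner ℝ ((hφ.deriv i).clm_comp (ContinuousLinearMap.toSpanSingleton ℝ c)).toL2 p.1
          = -inner ℝ (hφ.clm_comp (ContinuousLinearMap.toSpanSingleton ℝ c)).toL2 p.2} := by
    ext p
    simp only [Set.mem_iInter, Set.mem_ofPred_eq]
    refine forall₂_congr fun φ hφ => ?_
    have h1 := fun c => inner_toL2_smul_const (hφ.deriv i) c p.1
    have h2 := fun c => inner_toL2_smul_const hφ c p.2
    refine ⟨fun h c => ?_, fun h => ext_inner_left ℝ fun c => ?_⟩
    · rw [h1, h2, ← inner_neg_right]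
      exact congrArg (inner ℝ c) h
    · rw [inner_neg_right, ← h2, ← h c, h1]
      rfl
  rw [h]
  refine isClosed_iInter fun φ => isClosed_iInter fun hφ => isClosed_iInter fun c => ?_
  exact isClosed_eq (by fun_prop) (by fun_prop)

end WeakDerivatives

/-! ### H¹₀ as a closed space of jets -/

section SobolevSpace
variable {n : ℕ} {Ω : Set (Pt n)}

/-- Pairs of an `L²` function and a family of `n` candidate partial derivatives. -/
abbrev Jet (Ω : Set (Pt n)) : Type := PiLp 2 (fun _ : Option (Fin n) => L2 Ω)

theorem Jet.norm_sq (u : Jet Ω) : ‖u‖ ^ 2 = ‖u none‖ ^ 2 + ∑ i, ‖u (some i)‖ ^ 2 := by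
  rw [PiLp.norm_sq_eq_of_L2, Fintype.sum_option]

/-- The jets `(φ, ∂_1 φ, …, ∂_n φ)` of test functions. -/
noncomputable def testJets (Ω : Set (Pt n)) : Submodule ℝ (Jet Ω) where
  carrier := {u | ∃ φ : Pt n → Cl n, IsTestFunction Ω φ ∧ u none =ᵐ[volume.restrict Ω] φ ∧
    ∀ i, u (some i) =ᵐ[volume.restrict Ω] partialDeriv i φ}
  add_mem' := by
    rintro u v ⟨φ, hφ, h1, h2⟩ ⟨ψ, hψ, h3, h4⟩
    refine ⟨φ + ψ, hφ.add hψ, (Lp.coeFn_add _ _).trans (h1.add h3), fun i => ?_⟩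
    refine (Lp.coeFn_add _ _).trans (((h2 i).add (h4 i)).trans (Filter.EventuallyEq.of_eq ?_))
    funext x
    simp only [partialDeriv, Pi.add_apply]
    rw [fderiv_add (hφ.differentiable x) (hψ.differentiable x), add_apply]
  zero_mem' := by
    refine ⟨0, IsTestFunction.zero, Lp.coeFn_zero _ _ _, fun i => ?_⟩
    refine (Lp.coeFn_zero _ _ _).trans (Filter.EventuallyEq.of_eq ?_)
    funext x
    simp [partialDeriv]
  smul_mem' := by
    rintro c u ⟨φ, hφ, h1, h2⟩
    refine ⟨(c • ContinuousLinearMap.id ℝ (Cl n)) ∘ φ, hφ.clm_comp _,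
      (Lp.coeFn_smul _ _).trans (h1.const_smul c), fun i => ?_⟩
    rw [partialDeriv_clm_comp hφ.differentiable]
    exact (Lp.coeFn_smul _ _).trans ((h2 i).const_smul c)

/-- The jets of the elements of `H¹₀(Ω)`. -/
noncomputable def h10Jets (Ω : Set (Pt n)) : Submodule ℝ (Jet Ω) := (testJets Ω).topologicalClosure

theorem exists_testFunction_of_mem_testJets {u : Jet Ω} (h : u ∈ testJets Ω) :
    ∃ (φ : Pt n → Cl n) (hφ : IsTestFunction Ω φ),
      u none = hφ.toL2 ∧ ∀ i, u (some i) = (hφ.deriv i).toL2 := by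
  obtain ⟨φ, hφ, h1, h2⟩ := h
  exact ⟨φ, hφ, Lp.ext (h1.trans hφ.coeFn_toL2.symm),
    fun i => Lp.ext ((h2 i).trans (hφ.deriv i).coeFn_toL2.symm)⟩

theorem IsTestFunction.jet_mem {φ : Pt n → Cl n} (h : IsTestFunction Ω φ) :
    (WithLp.toLp 2 fun o : Option (Fin n) => o.elim h.toL2 fun i => (h.deriv i).toL2 : Jet Ω)
      ∈ testJets Ω :=
  ⟨φ, h, h.coeFn_toL2, fun i => (h.deriv i).coeFn_toL2⟩

theorem h10Jets_induction {p : Jet Ω → Prop} (hp : IsClosed {u | p u})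
    (h : ∀ u ∈ testJets Ω, p u) {u : Jet Ω} (hu : u ∈ h10Jets Ω) : p u :=
  closure_minimal (s := (testJets Ω : Set (Jet Ω))) h hp hu

/-- Integration by parts gives this for test functions, and closedness of the graph carries it to
limits. A jet in the closure is thus determined by its zeroth entry. -/
theorem hasWeakPartial_of_mem_h10Jets {u : Jet Ω} (hu : u ∈ h10Jets Ω) (i : Fin n) :
    HasWeakPartial Ω i (u none) (u (some i)) := by
  refine h10Jets_induction (p := fun u => HasWeakPartial Ω i (u none) (u (some i))) ?_ ?_ hu
  · exact (isClosed_hasWeakPartial Ω i).preimage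
      (f := fun u : Jet Ω => (u none, u (some i))) (by fun_prop)
  · intro v hv
    obtain ⟨φ, hφ, h1, h2⟩ := exists_testFunction_of_mem_testJets hv
    rw [h1, h2]
    exact hφ.hasWeakPartial i

theorem wderiv_of_mem_h10Jets (hΩ : IsOpen Ω) {u : Jet Ω} (hu : u ∈ h10Jets Ω) (i : Fin n) :
    wderiv Ω i (u none) = u (some i) :=
  (hasWeakPartial_of_mem_h10Jets hu i).wderiv_eq hΩ

theorem dNorm_sq (F : L2 Ω) : dNorm Ω F ^ 2 = ∑ i, ‖wderiv Ω i F‖ ^ 2 :=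
  Real.sq_sqrt (Finset.sum_nonneg fun _ _ => sq_nonneg _)

theorem dNorm_nonneg (F : L2 Ω) : 0 ≤ dNorm Ω F := Real.sqrt_nonneg _

theorem dNorm_sq_of_mem_h10Jets (hΩ : IsOpen Ω) {u : Jet Ω} (hu : u ∈ h10Jets Ω) :
    dNorm Ω (u none) ^ 2 = ∑ i, ‖u (some i)‖ ^ 2 := by
  simp only [dNorm_sq, wderiv_of_mem_h10Jets hΩ hu]

/-- The jet of weak derivatives of `F`. -/
noncomputable def weakJet (F : L2 Ω) : Jet Ω :=
  WithLp.toLp 2 fun o => o.elim F fun i => wderiv Ω i F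

/-- The ℓ² norm on jets is the H¹ norm. Approximation in H¹ and closure in the jet space therefore
mean the same thing, which identifies `H10` with `h10Jets`. -/
theorem norm_weakJet_sub (hΩ : IsOpen Ω) {F : L2 Ω} (hF : F ∈ H1 Ω) {φ : Pt n → Cl n}
    (hφ : IsTestFunction Ω φ) :
    ‖weakJet F - WithLp.toLp 2 fun o : Option (Fin n) =>
      o.elim hφ.toL2 fun i => (hφ.deriv i).toL2‖ = h1Norm Ω (F - hφ.toL2) := by
  have h : ∀ i, wderiv Ω i (F - hφ.toL2) = wderiv Ω i F - (hφ.deriv i).toL2 := fun i =>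
    ((hasWeakPartial_wderiv hF i).sub (hφ.hasWeakPartial i)).wderiv_eq hΩ
  rw [h1Norm, dNorm_sq, ← Real.sqrt_sq (norm_nonneg (weakJet F - _)), Jet.norm_sq]
  simp only [h]
  rfl

theorem weakJet_mem_h10Jets (hΩ : IsOpen Ω) {F : L2 Ω} (hF : F ∈ H10 Ω) :
    weakJet F ∈ h10Jets Ω := by
  refine Metric.mem_closure_iff.2 fun ε hε => ?_
  obtain ⟨φ, hφ, Φ, hΦ, h⟩ := hF.2 ε hε
  obtain rfl : Φ = hφ.toL2 := Lp.ext (hΦ.trans hφ.coeFn_toL2.symm)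
  refine ⟨_, hφ.jet_mem, ?_⟩
  rwa [dist_eq_norm, norm_weakJet_sub hΩ hF.1 hφ]

theorem weakJet_eq (hΩ : IsOpen Ω) {u : Jet Ω} (hu : u ∈ h10Jets Ω) : weakJet (u none) = u := by
  ext1 o
  cases o with
  | none => rfl
  | some i => exact wderiv_of_mem_h10Jets hΩ hu i

theorem mem_H10_of_mem_h10Jets (hΩ : IsOpen Ω) {u : Jet Ω} (hu : u ∈ h10Jets Ω) :
    u none ∈ H10 Ω := by
  have h1 : u none ∈ H1 Ω := fun i => ⟨_, hasWeakPartial_of_mem_h10Jets hu i⟩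
  refine ⟨h1, fun ε hε => ?_⟩
  obtain ⟨v, hv, h⟩ := Metric.mem_closure_iff.1 hu ε hε
  obtain ⟨φ, hφ, h2, h3⟩ := exists_testFunction_of_mem_testJets hv
  refine ⟨φ, hφ, hφ.toL2, hφ.coeFn_toL2, ?_⟩
  rw [← norm_weakJet_sub hΩ h1 hφ, weakJet_eq hΩ hu]
  convert h
  rw [dist_eq_norm]
  congr 2
  ext1 o
  cases o with
  | none => exact h2.symm
  | some i => exact (h3 i).symm

/-- Componentwise right multiplication by `a` on jets. -/
noncomputable def Jet.mulR (a : Cl n) (u : Jet Ω) : Jet Ω :=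
  WithLp.toLp 2 fun o => L2.mulR a (u o)

theorem Jet.continuous_mulR (a : Cl n) : Continuous (Jet.mulR (Ω := Ω) a) := by
  unfold Jet.mulR
  fun_prop

/-- Right multiplication by a constant commutes with differentiation and preserves test functions;
continuity extends this to the closure. -/
theorem Jet.mulR_mem_h10Jets (a : Cl n) {u : Jet Ω} (hu : u ∈ h10Jets Ω) :
    Jet.mulR a u ∈ h10Jets Ω := by
  refine h10Jets_induction (p := fun u => Jet.mulR a u ∈ h10Jets Ω) ?_ ?_ hu
  · exact (Submodule.isClosed_topologicalClosure _).preimage (Jet.continuous_mulR a)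
  · rintro v ⟨φ, hφ, h1, h2⟩
    refine Submodule.le_topologicalClosure _ ⟨Cl.mulR a ∘ φ, hφ.clm_comp _, ?_, fun i => ?_⟩
    · exact (L2.coeFn_mulR a _).trans (h1.fun_comp (Cl.mulR a))
    · rw [partialDeriv_clm_comp hφ.differentiable]
      exact (L2.coeFn_mulR a _).trans ((h2 i).fun_comp (Cl.mulR a))

end SobolevSpace

/-! ### Multiplication by the height y -/

section Height
variable {d : ℕ} {Ω : Set (Pt (d + 1))} {M : ℝ}

theorem continuous_height : Continuous (height (d := d)) := by
  unfold height
  fun_prop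

theorem memLp_height_smul (hM : ∀ᵐ x ∂volume.restrict Ω, |height x| ≤ M) (F : L2 Ω) :
    MemLp (fun x => height x • F x) 2 (volume.restrict Ω) :=
  MemLp.smul (Lp.memLp F)
    (memLp_top_of_bound continuous_height.aestronglyMeasurable M hM)

/-- Multiplication by the height `y` on `L²(Ω)`, where `y` is bounded. -/
noncomputable def heightMul (hM : ∀ᵐ x ∂volume.restrict Ω, |height x| ≤ M) :
    L2 Ω →L[ℝ] L2 Ω :=
  LinearMap.mkContinuous
    { toFun := fun F => (memLp_height_smul hM F).toLp _
      map_add' := fun F G => by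
        refine Lp.ext ?_
        filter_upwards [(memLp_height_smul hM (F + G)).coeFn_toLp,
          Lp.coeFn_add ((memLp_height_smul hM F).toLp _) ((memLp_height_smul hM G).toLp _),
          (memLp_height_smul hM F).coeFn_toLp, (memLp_height_smul hM G).coeFn_toLp,
          Lp.coeFn_add F G] with x h1 h2 h3 h4 h5
        rw [h1, h2, Pi.add_apply, h3, h4, h5, Pi.add_apply, smul_add]
      map_smul' := fun c F => by
        refine Lp.ext ?_
        filter_upwards [(memLp_height_smul hM (c • F)).coeFn_toLp,
          Lp.coeFn_smul c ((memLp_height_smul hM F).toLp _),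
          (memLp_height_smul hM F).coeFn_toLp, Lp.coeFn_smul c F] with x h1 h2 h3 h4
        rw [RingHom.id_apply, h1, h2, Pi.smul_apply, h3, h4, Pi.smul_apply, smul_comm] }
    M fun F => by
      refine Lp.norm_le_mul_norm_of_ae_le_mul ?_
      filter_upwards [(memLp_height_smul hM F).coeFn_toLp, hM] with x h1 h2
      change ‖(memLp_height_smul hM F).toLp _ x‖ ≤ _
      rw [h1, norm_smul, Real.norm_eq_abs]
      exact mul_le_mul_of_nonneg_right h2 (norm_nonneg _)

theorem coeFn_heightMul (hM : ∀ᵐ x ∂volume.restrict Ω, |height x| ≤ M) (F : L2 Ω) :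
    heightMul hM F =ᵐ[volume.restrict Ω] fun x => height x • F x :=
  (memLp_height_smul hM F).coeFn_toLp

theorem norm_heightMul_le (hM : ∀ᵐ x ∂volume.restrict Ω, |height x| ≤ M) (F : L2 Ω) :
    ‖heightMul hM F‖ ≤ M * ‖F‖ := by
  refine Lp.norm_le_mul_norm_of_ae_le_mul ?_
  filter_upwards [coeFn_heightMul hM F, hM] with x h1 h2
  rw [h1, norm_smul, Real.norm_eq_abs]
  exact mul_le_mul_of_nonneg_right h2 (norm_nonneg _)

theorem le_norm_heightMul (hM : ∀ᵐ x ∂volume.restrict Ω, |height x| ≤ M) {m : ℝ} (hm0 : 0 < m)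
    (hm : ∀ᵐ x ∂volume.restrict Ω, m ≤ height x) (F : L2 Ω) : m * ‖F‖ ≤ ‖heightMul hM F‖ := by
  rw [← le_inv_mul_iff₀ hm0]
  refine Lp.norm_le_mul_norm_of_ae_le_mul ?_
  filter_upwards [coeFn_heightMul hM F, hm] with x h1 h2
  rw [h1, norm_smul, Real.norm_eq_abs, le_inv_mul_iff₀ hm0]
  exact mul_le_mul_of_nonneg_right (h2.trans (le_abs_self _)) (norm_nonneg _)

theorem inner_heightMul_left (hM : ∀ᵐ x ∂volume.restrict Ω, |height x| ≤ M) (F G : L2 Ω) :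
    inner ℝ (heightMul hM F) G = inner ℝ F (heightMul hM G) := by
  rw [L2.inner_def, L2.inner_def]
  refine integral_congr_ae ?_
  filter_upwards [coeFn_heightMul hM F, coeFn_heightMul hM G] with x h1 h2
  rw [h1, h2, inner_smul_left, inner_smul_right]
  rfl

/-- Since ⟨∂_yφ, φ⟩ = ½∂_y|φ|² and ∂_y y = 1, one integration by parts suffices. -/
theorem integral_height_mul_inner_partialDeriv {φ : Pt (d + 1) → Cl (d + 1)}
    (hφ : IsTestFunction Ω φ) :
    ∫ x, height x * inner ℝ (partialDeriv (Fin.last d) φ x) (φ x)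
      = -(1 / 2) * ∫ x, inner ℝ (φ x) (φ x) := by
  set v : Pt (d + 1) := EuclideanSpace.single (Fin.last d) 1 with hv
  set g : Pt (d + 1) → ℝ := fun x => inner ℝ (φ x) (φ x) with hg
  have hgc : ContDiff ℝ ∞ g := hφ.1.inner ℝ hφ.1
  have hgs : HasCompactSupport g := hφ.2.1.comp_left (g := fun z : Cl (d + 1) => inner ℝ z z)
    (by simp)
  have hh : ∀ x : Pt (d + 1), HasFDerivAt height
      (EuclideanSpace.proj (Fin.last d) : Pt (d + 1) →L[ℝ] ℝ) x := fun x =>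
    (EuclideanSpace.proj (Fin.last d) : Pt (d + 1) →L[ℝ] ℝ).hasFDerivAt
  have hh1 : ∀ x : Pt (d + 1), fderiv ℝ height x v = 1 := fun x => by
    rw [(hh x).fderiv]; simp [hv]
  have hg' : ∀ x, fderiv ℝ g x v = 2 * inner ℝ (partialDeriv (Fin.last d) φ x) (φ x) := fun x => by
    rw [hg, fderiv_inner_apply ℝ (hφ.differentiable x) (hφ.differentiable x),
      real_inner_comm, ← two_mul]
    rfl
  -- The factor y lacks compact support, but g = |φ|² has it, which supplies all three integrability
  -- conditions.
  have h := integral_mul_fderiv_eq_neg_fderiv_mul_of_integrable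
    (μ := (volume : Measure (Pt (d + 1)))) (f := height) (g := g) (v := v)
    (by
      simp only [hh1, one_mul]
      exact hgc.continuous.integrable_of_hasCompactSupport hgs)
    ((continuous_height.mul ((hgc.continuous_fderiv (by simp)).clm_apply
      continuous_const)).integrable_of_hasCompactSupport (hgs.fderiv_apply ℝ v).mul_left)
    ((continuous_height.mul hgc.continuous).integrable_of_hasCompactSupport hgs.mul_left)
    (fun x _ => (hh x).differentiableAt) (fun x _ => (hgc.differentiable (by simp)) x)
  simp only [hh1, hg', one_mul, mul_left_comm _ (2 : ℝ), integral_const_mul] at h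
  linarith

theorem inner_heightMul_last_of_mem_h10Jets (hM : ∀ᵐ x ∂volume.restrict Ω, |height x| ≤ M)
    {u : Jet Ω} (hu : u ∈ h10Jets Ω) :
    inner ℝ (heightMul hM (u (some (Fin.last d)))) (u none) = -(1 / 2) * ‖u none‖ ^ 2 := by
  refine h10Jets_induction (p := fun u : Jet Ω =>
    inner ℝ (heightMul hM (u (some (Fin.last d)))) (u none) = -(1 / 2) * ‖u none‖ ^ 2) ?_ ?_ hu
  · exact isClosed_eq (by fun_prop) (by fun_prop)
  · intro v hv
    obtain ⟨φ, hφ, h1, h2⟩ := exists_testFunction_of_mem_testJets hv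
    rw [h1, h2, ← real_inner_self_eq_norm_sq, L2.inner_def, L2.inner_def]
    have h := integral_height_mul_inner_partialDeriv hφ
    have h3 : ∀ {g : Pt (d + 1) → Cl (d + 1)},
        ∫ x in Ω, (inner ℝ (g x) (φ x) : ℝ) = ∫ x, inner ℝ (g x) (φ x) := fun {g} =>
      setIntegral_eq_integral_of_forall_compl_eq_zero fun x hx => by
        rw [hφ.eq_zero_of_notMem hx, inner_zero_right]
    simp only [← real_inner_smul_left] at h
    rw [← h3, ← h3] at h
    convert h using 1
    · refine integral_congr_ae ?_
      filter_upwards [coeFn_heightMul hM (hφ.deriv (Fin.last d)).toL2, hφ.coeFn_toL2,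
        (hφ.deriv (Fin.last d)).coeFn_toL2] with x h4 h5 h6
      rw [h4, h5, h6]
    · congr 1
      refine integral_congr_ae ?_
      filter_upwards [hφ.coeFn_toL2] with x h5
      rw [h5]

end Height

/-! ### The scalar form on jets and its relation to q_s -/

section DirichletForm
variable {d : ℕ} {Ω : Set (Pt (d + 1))} {M : ℝ}

/-- The coordinate projections of jets. -/
noncomputable def Jet.proj {n : ℕ} {Ω : Set (Pt n)} (o : Option (Fin n)) : Jet Ω →L[ℝ] L2 Ω :=
  PiLp.proj 2 (fun _ : Option (Fin n) => L2 Ω) o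

@[simp] theorem Jet.proj_apply {n : ℕ} {Ω : Set (Pt n)} (o : Option (Fin n)) (u : Jet Ω) :
    Jet.proj o u = u o := rfl

/-- The inner product of `L²(Ω)` as a continuous bilinear form. -/
noncomputable def innerL {n : ℕ} (Ω : Set (Pt n)) : L2 Ω →L[ℝ] L2 Ω →L[ℝ] ℝ := innerSL ℝ

@[simp] theorem innerL_apply {n : ℕ} {Ω : Set (Pt n)} (F G : L2 Ω) :
    innerL Ω F G = inner ℝ F G := rfl

/-- The hyperbolic Dirac operator on jets. -/
noncomputable def diracL (hM : ∀ᵐ x ∂volume.restrict Ω, |height x| ≤ M) : Jet Ω →L[ℝ] L2 Ω :=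
  ∑ i, L2.mulL (Cl.e i) ∘L heightMul hM ∘L Jet.proj (some i)
    - alphaC (d + 1) • L2.mulL (Cl.e (Fin.last d)) ∘L Jet.proj none

theorem diracL_apply (hM : ∀ᵐ x ∂volume.restrict Ω, |height x| ≤ M) (u : Jet Ω) :
    diracL hM u = ∑ i, L2.mulL (Cl.e i) (heightMul hM (u (some i)))
      - alphaC (d + 1) • L2.mulL (Cl.e (Fin.last d)) (u none) := by
  simp [diracL]

/-- The part of the form `q_s` tested against the function itself rather than its derivatives. -/
noncomputable def lowerOrder (hM : ∀ᵐ x ∂volume.restrict Ω, |height x| ≤ M)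
    (s : EuclideanSpace ℝ (Fin (d + 2))) : Jet Ω →L[ℝ] L2 Ω :=
  (2 * (1 + alphaC (d + 1))) • heightMul hM ∘L Jet.proj (some (Fin.last d))
    + L2.mulESub (Fin.last d) (2 * s 0) ∘L diracL hM
    + (‖s‖ ^ 2 - betaC (d + 1)) • Jet.proj none

theorem lowerOrder_apply (hM : ∀ᵐ x ∂volume.restrict Ω, |height x| ≤ M)
    (s : EuclideanSpace ℝ (Fin (d + 2))) (u : Jet Ω) :
    lowerOrder hM s u = (2 * (1 + alphaC (d + 1))) • heightMul hM (u (some (Fin.last d)))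
      + L2.mulESub (Fin.last d) (2 * s 0) (diracL hM u)
      + (‖s‖ ^ 2 - betaC (d + 1)) • u none := rfl

/-- The scalar part of `q_s` on jets. -/
noncomputable def scalarForm (hM : ∀ᵐ x ∂volume.restrict Ω, |height x| ≤ M)
    (s : EuclideanSpace ℝ (Fin (d + 2))) : Jet Ω →L[ℝ] Jet Ω →L[ℝ] ℝ :=
  ∑ i, (innerL Ω).bilinearComp (heightMul hM ∘L heightMul hM ∘L Jet.proj (some i))
      (Jet.proj (some i))
    + (innerL Ω).bilinearComp (lowerOrder hM s) (Jet.proj none)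

theorem scalarForm_apply (hM : ∀ᵐ x ∂volume.restrict Ω, |height x| ≤ M)
    (s : EuclideanSpace ℝ (Fin (d + 2))) (u v : Jet Ω) :
    scalarForm hM s u v
      = ∑ i, inner ℝ (heightMul hM (heightMul hM (u (some i)))) (v (some i))
        + inner ℝ (lowerOrder hM s u) (v none) := by
  simp [scalarForm]

theorem L2.coeFn_sum {n : ℕ} {Ω : Set (Pt n)} {ι : Type*} (t : Finset ι) (F : ι → L2 Ω) :
    (∑ i ∈ t, F i : L2 Ω) =ᵐ[volume.restrict Ω] fun x => ∑ i ∈ t, F i x := by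
  classical
  induction t using Finset.induction_on with
  | empty => exact Lp.coeFn_zero (Cl n) 2 (volume.restrict Ω)
  | insert i t hi ih =>
    rw [Finset.sum_insert hi]
    filter_upwards [Lp.coeFn_add (F i) (∑ j ∈ t, F j), ih] with x h1 h2
    rw [h1, Pi.add_apply, h2, Finset.sum_insert hi]

theorem diracH_ae_eq (hM : ∀ᵐ x ∂volume.restrict Ω, |height x| ≤ M) (hΩ : IsOpen Ω)
    {u : Jet Ω} (hu : u ∈ h10Jets Ω) :
    diracL hM u =ᵐ[volume.restrict Ω] diracH Ω (u none) := by
  have h1 : ∀ i, L2.mulL (Cl.e i) (heightMul hM (u (some i))) =ᵐ[volume.restrict Ω]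
      fun x => Cl.e i * (height x • u (some i) x) := fun i => by
    filter_upwards [L2.coeFn_mulL (Cl.e i) (heightMul hM (u (some i))),
      coeFn_heightMul hM (u (some i))] with x h2 h3
    rw [h2, h3]
  rw [diracL_apply]
  filter_upwards [Lp.coeFn_sub (∑ i, L2.mulL (Cl.e i) (heightMul hM (u (some i))))
      (alphaC (d + 1) • L2.mulL (Cl.e (Fin.last d)) (u none)),
    L2.coeFn_sum Finset.univ fun i => L2.mulL (Cl.e i) (heightMul hM (u (some i))),
    ae_all_iff.2 h1, Lp.coeFn_smul (alphaC (d + 1)) (L2.mulL (Cl.e (Fin.last d)) (u none)),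
    L2.coeFn_mulL (Cl.e (Fin.last d)) (u none)] with x h2 h3 h4 h5 h6
  rw [h2, Pi.sub_apply, h3, h5, Pi.smul_apply, h6, diracH, Fin.sum_univ_castSucc]
  simp only [h4, wderiv_of_mem_h10Jets hΩ hu]
  abel

/-- Every term of q_s is a pairing whose second slot is G or one of its derivatives, so a moves onto
the whole test jet at once. -/
theorem Sc_qForm_mul (hM : ∀ᵐ x ∂volume.restrict Ω, |height x| ≤ M) (hΩ : IsOpen Ω)
    (s : EuclideanSpace ℝ (Fin (d + 2))) {u v : Jet Ω} (hu : u ∈ h10Jets Ω)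
    (hv : v ∈ h10Jets Ω) (a : Cl (d + 1)) :
    Cl.Sc (qForm Ω s (u none) (v none) * a) = scalarForm hM s u (Jet.mulR a v) := by
  have hSc : ∀ x y : Cl (d + 1), Cl.Sc (x + y) = Cl.Sc x + Cl.Sc y := fun _ _ => rfl
  have hsm : ∀ (c : ℝ) (x : Cl (d + 1)), Cl.Sc (c • x) = c * Cl.Sc x := fun _ _ => rfl
  have hsum : ∀ f : Fin d → Cl (d + 1), Cl.Sc (∑ i, f i) = ∑ i, Cl.Sc (f i) := fun f =>
    map_sum Cl.ScL f Finset.univ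
  have h1 : ∀ i, cinner Ω (fun x => height x ^ 2 • u (some i) x) (v (some i))
      = cinner Ω (heightMul hM (heightMul hM (u (some i)))) (v (some i)) := fun i => by
    refine cinner_congr ?_ Filter.EventuallyEq.rfl
    filter_upwards [coeFn_heightMul hM (heightMul hM (u (some i))),
      coeFn_heightMul hM (u (some i))] with x h2 h3
    rw [h2, h3, smul_smul, sq]
  have h2 : cinner Ω (fun x => height x • u (some (Fin.last d)) x) (v none)
      = cinner Ω (heightMul hM (u (some (Fin.last d)))) (v none) :=
    cinner_congr (coeFn_heightMul hM _).symm Filter.EventuallyEq.rfl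
  have h3 : cinner Ω (fun x => (Cl.e (Fin.last d) - algebraMap ℝ (Cl (d + 1)) (2 * s 0))
        * diracH Ω (u none) x) (v none)
      = cinner Ω (L2.mulESub (Fin.last d) (2 * s 0) (diracL hM u)) (v none) := by
    refine cinner_congr ?_ Filter.EventuallyEq.rfl
    filter_upwards [L2.coeFn_mulESub (Fin.last d) (2 * s 0) (diracL hM u),
      diracH_ae_eq hM hΩ hu] with x h4 h5
    rw [h4, h5]
  have h4 : cinner Ω (fun x => (‖s‖ ^ 2 - betaC (d + 1)) • u none x) (v none)
      = cinner Ω ((‖s‖ ^ 2 - betaC (d + 1)) • u none : L2 Ω) (v none) :=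
    cinner_congr (Lp.coeFn_smul (‖s‖ ^ 2 - betaC (d + 1)) (u none)).symm Filter.EventuallyEq.rfl
  simp only [qForm, wderiv_of_mem_h10Jets hΩ hu, wderiv_of_mem_h10Jets hΩ hv, h1, h2, h3, h4,
    add_mul, Finset.sum_mul, Cl.smul_mul', hSc, hsm, hsum, Sc_cinner_mul]
  rw [scalarForm_apply, lowerOrder_apply, Fin.sum_univ_castSucc, inner_add_left, inner_add_left]
  simp only [Jet.mulR, real_inner_smul_left]
  ring

/-! ### Poincaré inequality and coercivity -/

theorem sum_norm_le_sqrt_card_mul_dNorm (hΩ : IsOpen Ω) {u : Jet Ω} (hu : u ∈ h10Jets Ω) :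
    ∑ i, ‖u (some i)‖ ≤ √((d + 1 : ℕ) : ℝ) * dNorm Ω (u none) := by
  refine (sq_le_sq₀ (Finset.sum_nonneg fun _ _ => norm_nonneg _)
    (mul_nonneg (Real.sqrt_nonneg _) (dNorm_nonneg _))).1 ?_
  rw [mul_pow, Real.sq_sqrt (Nat.cast_nonneg _), dNorm_sq_of_mem_h10Jets hΩ hu]
  simpa using sq_sum_le_card_mul_sum_sq (s := Finset.univ) (f := fun i => ‖u (some i)‖)

/-- From N²/2 = |⟨y∂_yF, F⟩| ≤ M·D·N one divides by N. This makes 2M a Poincaré constant. -/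
theorem norm_le_two_mul_dNorm (hM : ∀ᵐ x ∂volume.restrict Ω, |height x| ≤ M) (hM0 : 0 ≤ M)
    (hΩ : IsOpen Ω) {u : Jet Ω} (hu : u ∈ h10Jets Ω) :
    ‖u none‖ ≤ 2 * M * dNorm Ω (u none) := by
  have h1 := inner_heightMul_last_of_mem_h10Jets hM hu
  have h2 := abs_real_inner_le_norm (heightMul hM (u (some (Fin.last d)))) (u none)
  have h3 := norm_heightMul_le hM (u (some (Fin.last d)))
  have h4 : ‖u (some (Fin.last d))‖ ≤ dNorm Ω (u none) := by
    refine (sq_le_sq₀ (norm_nonneg _) (dNorm_nonneg _)).1 ?_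
    rw [dNorm_sq_of_mem_h10Jets hΩ hu]
    exact Finset.single_le_sum (f := fun i => ‖u (some i)‖ ^ 2) (fun _ _ => sq_nonneg _)
      (Finset.mem_univ _)
  rw [h1, abs_of_nonpos (by nlinarith [sq_nonneg ‖u none‖])] at h2
  have h5 : ‖heightMul hM (u (some (Fin.last d)))‖ ≤ M * dNorm Ω (u none) :=
    h3.trans (mul_le_mul_of_nonneg_left h4 hM0)
  rcases (norm_nonneg (u none)).eq_or_lt with h0 | h0
  · rw [← h0]
    have := dNorm_nonneg (u none)
    positivity
  · refine le_of_mul_le_mul_right ?_ h0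
    nlinarith [mul_le_mul_of_nonneg_right h5 h0.le]

theorem norm_sum_mulL_heightMul_le (hM : ∀ᵐ x ∂volume.restrict Ω, |height x| ≤ M) (hM0 : 0 ≤ M)
    (hΩ : IsOpen Ω) {u : Jet Ω} (hu : u ∈ h10Jets Ω) :
    ‖∑ i, L2.mulL (Cl.e i) (heightMul hM (u (some i)))‖
      ≤ M * (√((d + 1 : ℕ) : ℝ) * dNorm Ω (u none)) := by
  refine (norm_sum_le _ _).trans ?_
  refine (Finset.sum_le_sum (g := fun i => M * ‖u (some i)‖) fun i _ => ?_).trans ?_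
  · rw [L2.norm_mulL_e]
    exact norm_heightMul_le hM _
  · rw [← Finset.mul_sum]
    exact mul_le_mul_of_nonneg_left (sum_norm_le_sqrt_card_mul_dNorm hΩ hu) hM0

/-- The height identity contributes -(1+α)N² and the zeroth-order term of the Dirac operator
contributes +αN², since e_n² = -1 and multiplication by e_n is skew. Their sum is -N². -/
theorem inner_lowerOrder_self (hM : ∀ᵐ x ∂volume.restrict Ω, |height x| ≤ M)
    (s : EuclideanSpace ℝ (Fin (d + 2))) {u : Jet Ω} (hu : u ∈ h10Jets Ω) :
    inner ℝ (lowerOrder hM s u) (u none)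
      = (‖s‖ ^ 2 - betaC (d + 1) - 1) * ‖u none‖ ^ 2
        + inner ℝ (L2.mulESub (Fin.last d) (2 * s 0)
            (∑ i, L2.mulL (Cl.e i) (heightMul hM (u (some i))))) (u none) := by
  have h : inner ℝ (L2.mulESub (Fin.last d) (2 * s 0) (L2.mulL (Cl.e (Fin.last d)) (u none)))
      (u none) = -‖u none‖ ^ 2 := by
    rw [L2.mulESub_apply, L2.mulL_e_mulL_e, inner_sub_left, inner_neg_left,
      real_inner_self_eq_norm_sq, real_inner_smul_left, L2.inner_mulL_e_self]
    ring
  rw [lowerOrder_apply, diracL_apply, map_sub, map_smul, inner_add_left, inner_add_left,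
    inner_sub_left, real_inner_smul_left, real_inner_smul_left, real_inner_smul_left, h,
    inner_heightMul_last_of_mem_h10Jets hM hu, real_inner_self_eq_norm_sq]
  ring

/-- The two halves of the factor 2(1+α) + √n√(1+4s₀²) in K play separate roles: the first absorbs
the zeroth-order loss, the second the first-order part of the Dirac operator. -/
theorem KP_mul_dNorm_sq_le (hM : ∀ᵐ x ∂volume.restrict Ω, |height x| ≤ M) {m : ℝ} (hm0 : 0 < m)
    (hmM : m ≤ M) (hm : ∀ᵐ x ∂volume.restrict Ω, m ≤ height x) (hΩ : IsOpen Ω) {C : ℝ}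
    (hC : IsPoincareConstant Ω C) (s : EuclideanSpace ℝ (Fin (d + 2)))
    (hK : 0 < KP (d + 1) m M C s) {u : Jet Ω} (hu : u ∈ h10Jets Ω) :
    KP (d + 1) m M C s * dNorm Ω (u none) ^ 2 ≤ scalarForm hM s u u := by
  have hM0 : 0 < M := hm0.trans_le hmM
  set D := dNorm Ω (u none) with hD
  set N := ‖u none‖ with hN
  set α := alphaC (d + 1) with hα
  set r := √(1 + 4 * s 0 ^ 2) with hr
  have hD0 : 0 ≤ D := dNorm_nonneg _
  have hN0 : 0 ≤ N := norm_nonneg _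
  have hC0 : 0 < C := hC.1
  have hND : N ≤ C * D := hC.2 _ (mem_H10_of_mem_h10Jets hΩ hu)
  have hα0 : 0 ≤ α := by
    rw [hα, alphaC]; push_cast; have : (0 : ℝ) ≤ d := Nat.cast_nonneg d; linarith
  have hr0 : 0 ≤ r := Real.sqrt_nonneg _
  have hfirst : m ^ 2 * D ^ 2
      ≤ ∑ i, inner ℝ (heightMul hM (heightMul hM (u (some i)))) (u (some i)) := by
    rw [hD, dNorm_sq_of_mem_h10Jets hΩ hu, Finset.mul_sum]
    refine Finset.sum_le_sum fun i _ => ?_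
    rw [inner_heightMul_left, real_inner_self_eq_norm_sq, ← mul_pow]
    exact pow_le_pow_left₀ (by positivity) (le_norm_heightMul hM hm0 hm _) 2
  have hcross : -(r * (M * (√((d + 1 : ℕ) : ℝ) * D)) * N)
      ≤ inner ℝ (L2.mulESub (Fin.last d) (2 * s 0)
            (∑ i, L2.mulL (Cl.e i) (heightMul hM (u (some i))))) (u none) := by
    refine (neg_le_neg ?_).trans (neg_le_of_abs_le (abs_real_inner_le_norm _ _))
    rw [L2.norm_mulESub, mul_pow, show (2 : ℝ) ^ 2 = 4 by norm_num]
    exact mul_le_mul_of_nonneg_right (mul_le_mul_of_nonneg_left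
      (norm_sum_mulL_heightMul_le hM hM0.le hΩ hu) hr0) hN0
  set q := √((d + 1 : ℕ) : ℝ) with hq
  have hq0 : 0 ≤ q := Real.sqrt_nonneg _
  have habs := abs_nonneg (|‖s‖ ^ 2 - betaC (d + 1)| - α * r)
  have hKle : KP (d + 1) m M C s ≤ m ^ 2 - C * M * (2 * (1 + α) + q * r) := by
    have : 0 ≤ |(|‖s‖ ^ 2 - betaC (d + 1)|) - α * r| * C ^ 2 := by positivity
    have h : KP (d + 1) m M C s = m ^ 2 - C * M * (2 * (1 + α) + q * r)
      - |(|‖s‖ ^ 2 - betaC (d + 1)|) - α * r| * C ^ 2 := rfl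
    linarith
  have hmM2 : m ^ 2 ≤ M ^ 2 := pow_le_pow_left₀ hm0.le hmM 2
  -- Positivity of K gives 2(1+α)CM < m² ≤ M²; divide by M.
  have hCM : C * (2 * (1 + α)) ≤ M := by
    refine le_of_mul_le_mul_right ?_ hM0
    have : 0 ≤ C * M * (q * r) := by positivity
    nlinarith
  -- Uses 1+α+α² ≤ 2(1+α)², then the previous bound on one factor 2(1+α).
  have hCM2 : C * (1 + α + α ^ 2) ≤ 2 * (1 + α) * M := by
    have h1 : C * (1 + α + α ^ 2) ≤ C * (2 * (1 + α)) * (1 + α) := by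
      nlinarith [mul_nonneg hC0.le hα0, mul_nonneg hC0.le (sq_nonneg α)]
    have h2 := mul_le_mul_of_nonneg_right hCM (by linarith : 0 ≤ 1 + α)
    nlinarith [mul_nonneg hM0.le hα0]
  have hN2 : N ^ 2 ≤ C ^ 2 * D ^ 2 := by
    rw [← mul_pow]; exact pow_le_pow_left₀ hN0 hND 2
  have hzero : -(C * M * (2 * (1 + α)) * D ^ 2) ≤ (‖s‖ ^ 2 - betaC (d + 1) - 1) * N ^ 2 := by
    -- Only |s|² ≥ 0 is used here, so the sign of |s|² - β_n plays no role.
    have h1 : -(1 + α + α ^ 2) ≤ ‖s‖ ^ 2 - betaC (d + 1) - 1 := by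
      rw [betaC, ← hα]; linarith [sq_nonneg ‖s‖]
    have h2 := mul_le_mul_of_nonneg_right h1 (sq_nonneg N)
    have h3 := mul_le_mul_of_nonneg_left hN2 (by positivity : 0 ≤ 1 + α + α ^ 2)
    have h4 := mul_le_mul_of_nonneg_left hCM2 (by positivity : 0 ≤ C * D ^ 2)
    linarith
  have hcross2 : r * (M * (q * D)) * N ≤ C * M * (q * r) * D ^ 2 := by
    have h1 := mul_le_mul_of_nonneg_left hND (by positivity : 0 ≤ r * (M * (q * D)))
    linarith
  have hKD := mul_le_mul_of_nonneg_right hKle (sq_nonneg D)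
  rw [scalarForm_apply, inner_lowerOrder_self hM s hu]
  linarith

/-! ### Existence, uniqueness and bounds for weak solutions -/

theorem exists_isPoincareConstant (hM : ∀ᵐ x ∂volume.restrict Ω, |height x| ≤ M) (hM0 : 0 < M)
    (hΩ : IsOpen Ω) : ∃ C, IsPoincareConstant Ω C :=
  ⟨2 * M, mul_pos two_pos hM0, fun F hF =>
    norm_le_two_mul_dNorm (u := weakJet F) hM hM0.le hΩ (weakJet_mem_h10Jets hΩ hF)⟩

/-- Being a weak solution can be tested with the scalar part of the form. -/
theorem isWeakSolution_iff (hM : ∀ᵐ x ∂volume.restrict Ω, |height x| ≤ M) (hΩ : IsOpen Ω)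
    (s : EuclideanSpace ℝ (Fin (d + 2))) (f : L2 Ω) {u : Jet Ω} (hu : u ∈ h10Jets Ω) :
    IsWeakSolution Ω s f (u none)
      ↔ ∀ v ∈ h10Jets Ω, scalarForm hM s u v = inner ℝ f (v none) := by
  constructor
  · intro h v hv
    have h1 := Sc_qForm_mul hM hΩ s hu hv 1
    have h2 : Jet.mulR 1 v = v := by
      ext1 o
      refine Lp.ext ((L2.coeFn_mulR 1 (v o)).trans (Filter.EventuallyEq.of_eq ?_))
      simp only [mul_one]
    rw [h.2 _ (mem_H10_of_mem_h10Jets hΩ hv), Sc_cinner_mul, h2] at h1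
    rw [← h1]
    exact congrArg (fun w : Jet Ω => inner ℝ f (w none)) h2
  · refine fun h => ⟨mem_H10_of_mem_h10Jets hΩ hu, fun G hG => ?_⟩
    have hv := weakJet_mem_h10Jets hΩ hG
    refine Cl.eq_of_Sc_mul_basis fun A => ?_
    have h1 := Sc_qForm_mul hM hΩ s hu hv (Cl.basis A)
    rw [h _ (Jet.mulR_mem_h10Jets _ hv)] at h1
    rw [Sc_cinner_mul]
    exact h1

theorem isCoercive_scalarForm (hM : ∀ᵐ x ∂volume.restrict Ω, |height x| ≤ M) {m : ℝ}
    (hm0 : 0 < m) (hmM : m ≤ M) (hm : ∀ᵐ x ∂volume.restrict Ω, m ≤ height x) (hΩ : IsOpen Ω)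
    {C : ℝ} (hC : IsPoincareConstant Ω C) (s : EuclideanSpace ℝ (Fin (d + 2)))
    (hK : 0 < KP (d + 1) m M C s) :
    IsCoercive ((scalarForm hM s).bilinearComp (h10Jets Ω).subtypeL (h10Jets Ω).subtypeL) := by
  have hC1 : 0 < C ^ 2 + 1 := by positivity
  -- The Poincaré inequality bounds the full jet norm: N² + D² ≤ (C²+1)D².
  refine ⟨KP (d + 1) m M C s / (C ^ 2 + 1), div_pos hK hC1, fun u => ?_⟩
  have h1 := KP_mul_dNorm_sq_le hM hm0 hmM hm hΩ hC s hK u.2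
  have h2 : ‖(u : Jet Ω)‖ ^ 2 ≤ (C ^ 2 + 1) * dNorm Ω ((u : Jet Ω) none) ^ 2 := by
    rw [Jet.norm_sq, ← dNorm_sq_of_mem_h10Jets hΩ u.2, add_mul, one_mul, ← mul_pow]
    gcongr
    exact hC.2 _ (mem_H10_of_mem_h10Jets hΩ u.2)
  refine le_trans ?_ h1
  rw [mul_assoc, ← sq, div_mul_eq_mul_div, div_le_iff₀ hC1, mul_assoc]
  refine mul_le_mul_of_nonneg_left ?_ hK.le
  rw [mul_comm]
  exact h2

/-- Lax–Milgram makes the form ⟨Lu, v⟩ with L invertible, and Riesz represents the right-hand side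
by g. Weak solutions are then exactly the jets with Lu = g. -/
theorem existsUnique_isWeakSolution (hM : ∀ᵐ x ∂volume.restrict Ω, |height x| ≤ M) {m : ℝ}
    (hm0 : 0 < m) (hmM : m ≤ M) (hm : ∀ᵐ x ∂volume.restrict Ω, m ≤ height x) (hΩ : IsOpen Ω)
    {C : ℝ} (hC : IsPoincareConstant Ω C) (s : EuclideanSpace ℝ (Fin (d + 2)))
    (hK : 0 < KP (d + 1) m M C s) (f : L2 Ω) : ∃! F : L2 Ω, IsWeakSolution Ω s f F := by
  have hV : CompleteSpace (h10Jets Ω) :=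
    (Submodule.isClosed_topologicalClosure _).completeSpace_coe
  have hB := isCoercive_scalarForm hM hm0 hmM hm hΩ hC s hK
  set L := hB.continuousLinearEquivOfBilin with hL
  let ℓ : h10Jets Ω →L[ℝ] ℝ := innerL Ω f ∘L Jet.proj none ∘L (h10Jets Ω).subtypeL
  let g : h10Jets Ω := (InnerProductSpace.toDual ℝ (h10Jets Ω)).symm ℓ
  have hg : ∀ v : h10Jets Ω, inner ℝ g v = inner ℝ f ((v : Jet Ω) none) := fun v =>
    InnerProductSpace.toDual_symm_apply
  have hsol : ∀ u : h10Jets Ω, IsWeakSolution Ω s f ((u : Jet Ω) none) ↔ L u = g := fun u => by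
    rw [isWeakSolution_iff hM hΩ s f u.2]
    constructor
    · refine fun h => ext_inner_right ℝ fun v => ?_
      rw [hg, hL, IsCoercive.continuousLinearEquivOfBilin_apply]
      exact h v v.2
    · intro h v hv
      rw [← hg ⟨v, hv⟩, ← h, hL, IsCoercive.continuousLinearEquivOfBilin_apply]
      rfl
  refine ⟨((L.symm g : h10Jets Ω) : Jet Ω) none, (hsol _).2 (L.apply_symm_apply g), ?_⟩
  intro F hF
  have h := (hsol ⟨weakJet F, weakJet_mem_h10Jets hΩ hF.1⟩).1 hF
  rw [← h, L.symm_apply_apply]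
  rfl

/-- Testing with F itself gives K·D² ≤ ⟨f, F⟩ ≤ ‖f‖·C·D; the case D = 0 is separated before dividing
by D. -/
theorem IsWeakSolution.dNorm_le (hM : ∀ᵐ x ∂volume.restrict Ω, |height x| ≤ M) {m : ℝ}
    (hm0 : 0 < m) (hmM : m ≤ M) (hm : ∀ᵐ x ∂volume.restrict Ω, m ≤ height x) (hΩ : IsOpen Ω)
    {C : ℝ} (hC : IsPoincareConstant Ω C) {s : EuclideanSpace ℝ (Fin (d + 2))}
    (hK : 0 < KP (d + 1) m M C s) {f F : L2 Ω} (hF : IsWeakSolution Ω s f F) :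
    dNorm Ω F ≤ C / KP (d + 1) m M C s * ‖f‖ := by
  have hu := weakJet_mem_h10Jets hΩ hF.1
  have h1 : KP (d + 1) m M C s * dNorm Ω F ^ 2 ≤ inner ℝ f F :=
    (KP_mul_dNorm_sq_le hM hm0 hmM hm hΩ hC s hK hu).trans_eq
      ((isWeakSolution_iff hM hΩ s f hu).1 hF _ hu)
  have h2 : inner ℝ f F ≤ ‖f‖ * (C * dNorm Ω F) :=
    (real_inner_le_norm f F).trans (mul_le_mul_of_nonneg_left (hC.2 F hF.1) (norm_nonneg _))
  rw [div_mul_eq_mul_div, le_div_iff₀ hK]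
  rcases (dNorm_nonneg F).eq_or_lt with h0 | h0
  · rw [← h0, zero_mul]
    exact mul_nonneg hC.1.le (norm_nonneg _)
  · refine le_of_mul_le_mul_right ?_ h0
    linarith

end DirichletForm

theorem mainTheorem3 (d : ℕ) (hd : 1 ≤ d) (Ω : Set (Pt (d + 1))) (hΩ : IsOpen Ω)
    (m M : ℝ) (hm : 0 < m) (hmM : m < M)
    (hinf : IsGLB (height '' Ω) m) (hsup : IsLUB (height '' Ω) M) :
    (∃ C, IsPoincareConstant Ω C) ∧
    ∀ C : ℝ, IsPoincareConstant Ω C →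
    ∀ s : EuclideanSpace ℝ (Fin (d + 2)), 0 < KP (d + 1) m M C s →
    ∀ f : L2 Ω,
      (∃! F : L2 Ω, IsWeakSolution Ω s f F) ∧
      ∀ F : L2 Ω, IsWeakSolution Ω s f F →
        dNorm Ω F ≤ C / KP (d + 1) m M C s * ‖f‖ ∧
        ‖F‖ ≤ C ^ 2 / KP (d + 1) m M C s * ‖f‖ := by
  have hlow : ∀ᵐ x ∂volume.restrict Ω, m ≤ height x :=
    (ae_restrict_iff' hΩ.measurableSet).2 (.of_forall fun x hx => hinf.1 ⟨x, hx, rfl⟩)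
  have hupp : ∀ᵐ x ∂volume.restrict Ω, |height x| ≤ M :=
    (ae_restrict_iff' hΩ.measurableSet).2 (.of_forall fun x hx => abs_le.2
      ⟨by linarith [hinf.1 ⟨x, hx, rfl⟩], hsup.1 ⟨x, hx, rfl⟩⟩)
  refine ⟨exists_isPoincareConstant hupp (hm.trans hmM) hΩ, fun C hC s hK f =>
    ⟨existsUnique_isWeakSolution hupp hm hmM.le hlow hΩ hC s hK f, fun F hF => ?_⟩⟩
  have h1 := hF.dNorm_le hupp hm hmM.le hlow hΩ hC hK
  refine ⟨h1, (hC.2 F hF.1).trans ?_⟩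
  calc C * dNorm Ω F ≤ C * (C / KP (d + 1) m M C s * ‖f‖) :=
        mul_le_mul_of_nonneg_left h1 hC.1.le
    _ = C ^ 2 / KP (d + 1) m M C s * ‖f‖ := by ring
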